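/- Let $k$ be a field of characteristic zero and let $H$ be a Hopf algebra over $k$ with counit $\varepsilon_H$. The coradical $C_{(0)}$ of a coalgebra $C$ is the sum of all its simple subcoalgebras, and its coradical filtration is given by $C_{(n)}=\Delta^{-1}\big(C\otimes C_{(n-1)}+C_{(0)}\otimes C\big)$ for $n\ge 1$ and $C_{(n)}=0$ for $n<0$. Assume that $H$ is connected, i.e. that $\dim_k H_{(0)}=1$ (no grading is assumed), and let $K$ be a Hopf subalgebra of $H$, with its own coradical filtration $\{K_{(n)}\}$. For $a\in H$ let $\rho_H(a)$ be the smallest $n\ge 0$ with $a\in H_{(n)}$. A filter basis of $H$ as a left (resp. right) $K$-module is a basis $(a_i)_{i\in I}$ of the left (resp. right) $K$-module $H$ such that $$H_{(n)}=\sum_{i\in I}K_{(n-\rho_H(a_i))}\,a_i\qquad\Big(\text{resp. } H_{(n)}=\sum_{i\in I}a_i\,K_{(n-\rho_H(a_i))}\Big)\qquad\text{for all } n\ge 0.$$ Then there are a totally ordered set $(\Gamma,\le)$ and a family $(x_\gamma)_{\gamma\in\Gamma}$ of elements of $\ker(\varepsilon_H)$ such that $$\operatorname{gkdim}H=\operatorname{gkdim}K+\#(\Gamma),$$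 and the family of monomials $x_{\gamma_1}\cdots x_{\gamma_n}$, indexed by all finite sequences $\gamma_1\le\cdots\le\gamma_n$ in $\Gamma$ with $n\ge 0$ (the empty product being $1$), is a filter basis of $H$ both as a left $K$-module and as a right $K$-module. Here $\#(\Gamma)\in\mathbb{N}\cup\{\infty\}$ is the number of elements of $\Gamma$, and $\operatorname{gkdim}A=\sup_V\limsup_{n\to\infty}\log_n\dim_k(V^0+V^1+\cdots+V^n)\in[0,\infty]$ is the Gelfand–Kirillov dimension of a nonzero algebra $A$, where $V$ runs over the finite-dimensional subspaces of $A$. -/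

import Mathlib

open scoped TensorProduct ENNReal

universe u v

section CoalgebraNotions

variable (k : Type*) [Field k] {C : Type*} [AddCommGroup C] [Module k C] [Coalgebra k C]

/-- A subspace `D` of a coalgebra `C` is a subcoalgebra if `Δ(D) ⊆ D ⊗ D`, where `D ⊗ D` is
regarded as a subspace of `C ⊗ C`. -/
def IsSubcoalgebra (D : Submodule k C) : Prop :=
  ∀ d ∈ D, Coalgebra.comul (R := k) d ∈ LinearMap.range (TensorProduct.mapIncl D D)

/-- A subcoalgebra is simple if it is nonzero and its only subcoalgebras are zero and itself. -/
def IsSimpleSubcoalgebra (D : Submodule k C) : Prop :=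
  IsSubcoalgebra k D ∧ D ≠ ⊥ ∧
    ∀ E : Submodule k C, E ≤ D → IsSubcoalgebra k E → E = ⊥ ∨ E = D

variable (C) in
/-- The coradical `C₍₀₎`: the sum of all simple subcoalgebras. -/
def coradical : Submodule k C :=
  sSup {D : Submodule k C | IsSimpleSubcoalgebra k D}

variable (C) in
/-- The coradical filtration: `C₍₀₎` is the coradical, and
`C₍ₙ₊₁₎ = Δ⁻¹(C ⊗ C₍ₙ₎ + C₍₀₎ ⊗ C)`. -/
def coradicalFiltration : ℕ → Submodule k C
  | 0 => coradical k C
  | n + 1 =>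
      (LinearMap.range (TensorProduct.mapIncl (⊤ : Submodule k C) (coradicalFiltration n)) ⊔
        LinearMap.range (TensorProduct.mapIncl (coradical k C) (⊤ : Submodule k C))).comap
        Coalgebra.comul

/-- `ρ(a)`: the smallest `n` with `a ∈ C₍ₙ₎`. (The coradical filtration of a coalgebra over a field
is always exhaustive, so the set below is nonempty.) -/
noncomputable def coradicalDegree (a : C) : ℕ :=
  sInf {n : ℕ | a ∈ coradicalFiltration k C n}

end CoalgebraNotions

section SubcoalgebraStructure

variable {k : Type*} [Field k] {C : Type*} [AddCommGroup C] [Module k C]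

theorem mapIncl_injective (D E : Submodule k C) :
    Function.Injective (TensorProduct.mapIncl D E) :=
  TensorProduct.map_injective_of_flat_flat' _ _ D.injective_subtype E.injective_subtype

variable [Coalgebra k C]

/-- The restriction `D → D ⊗ D` of the comultiplication to a subcoalgebra `D`. -/
noncomputable def IsSubcoalgebra.comul {D : Submodule k C} (hD : IsSubcoalgebra k D) :
    D →ₗ[k] D ⊗[k] D :=
  (LinearEquiv.ofInjective (TensorProduct.mapIncl D D) (mapIncl_injective D D)).symm.toLinearMap ∘ₗ
    (Coalgebra.comul ∘ₗ D.subtype).codRestrict (LinearMap.range (TensorProduct.mapIncl D D))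
      (fun d => hD d d.2)

theorem IsSubcoalgebra.mapIncl_comp_comul {D : Submodule k C} (hD : IsSubcoalgebra k D) :
    TensorProduct.mapIncl D D ∘ₗ hD.comul = Coalgebra.comul ∘ₗ D.subtype := by
  ext d
  have := LinearEquiv.apply_symm_apply
    (LinearEquiv.ofInjective (TensorProduct.mapIncl D D) (mapIncl_injective D D))
    ((Coalgebra.comul ∘ₗ D.subtype).codRestrict (LinearMap.range (TensorProduct.mapIncl D D))
      (fun d => hD d d.2) d)
  exact congrArg Subtype.val this

/-- A subcoalgebra is a coalgebra, with the restricted comultiplication and counit. -/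
@[reducible]
noncomputable def IsSubcoalgebra.coalgebra {D : Submodule k C} (hD : IsSubcoalgebra k D) :
    Coalgebra k D where
  comul := hD.comul
  counit := Coalgebra.counit ∘ₗ D.subtype
  coassoc := by
    have key := hD.mapIncl_comp_comul
    have hinj : Function.Injective
        (TensorProduct.map D.subtype (TensorProduct.mapIncl D D)) :=
      TensorProduct.map_injective_of_flat_flat' _ _ D.injective_subtype (mapIncl_injective D D)
    have h1 : TensorProduct.map D.subtype (TensorProduct.mapIncl D D) ∘ₗ
        (TensorProduct.assoc k D D D).toLinearMap ∘ₗ hD.comul.rTensor D =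
        (TensorProduct.assoc k C C C).toLinearMap ∘ₗ Coalgebra.comul.rTensor C ∘ₗ
          TensorProduct.mapIncl D D := by
      have e1 : TensorProduct.map D.subtype (TensorProduct.mapIncl D D) ∘ₗ
          (TensorProduct.assoc k D D D).toLinearMap =
          (TensorProduct.assoc k C C C).toLinearMap ∘ₗ
            TensorProduct.map (TensorProduct.mapIncl D D) D.subtype := by
        apply TensorProduct.ext_threefold
        intro x y z
        rfl
      rw [← LinearMap.comp_assoc, e1, LinearMap.comp_assoc]
      congr 1
      rw [LinearMap.rTensor, LinearMap.rTensor, TensorProduct.mapIncl, ← TensorProduct.map_comp,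
        ← TensorProduct.map_comp, ← key]
      rfl
    have h2 : TensorProduct.map D.subtype (TensorProduct.mapIncl D D) ∘ₗ hD.comul.lTensor D =
        Coalgebra.comul.lTensor C ∘ₗ TensorProduct.mapIncl D D := by
      rw [LinearMap.lTensor, LinearMap.lTensor, TensorProduct.mapIncl, ← TensorProduct.map_comp,
        ← TensorProduct.map_comp, ← key]
      rfl
    ext d
    apply hinj
    have a1 := LinearMap.congr_fun h1 (hD.comul d)
    have a2 := LinearMap.congr_fun h2 (hD.comul d)
    have a3 := LinearMap.congr_fun key d
    simp only [LinearMap.comp_apply, LinearEquiv.coe_coe, Submodule.coe_subtype] at a1 a2 a3 ⊢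
    rw [a1, a2, a3]
    exact Coalgebra.coassoc_apply (R := k) (d : C)
  rTensor_counit_comp_comul := by
    have key := hD.mapIncl_comp_comul
    have hinj : Function.Injective (D.subtype.lTensor k) :=
      Module.Flat.lTensor_preserves_injective_linearMap _ D.injective_subtype
    have h1 : D.subtype.lTensor k ∘ₗ
        (Coalgebra.counit (R := k) (A := C) ∘ₗ D.subtype).rTensor D =
        (Coalgebra.counit (R := k) (A := C)).rTensor C ∘ₗ TensorProduct.mapIncl D D :=
      TensorProduct.ext' fun _ _ => rfl
    ext d
    apply hinj
    have a1 := LinearMap.congr_fun h1 (hD.comul d)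
    have a3 := LinearMap.congr_fun key d
    simp only [LinearMap.comp_apply, Submodule.coe_subtype] at a1 a3 ⊢
    rw [a1, a3, Coalgebra.rTensor_counit_comul]
    rfl
  lTensor_counit_comp_comul := by
    have key := hD.mapIncl_comp_comul
    have hinj : Function.Injective (D.subtype.rTensor k) :=
      Module.Flat.rTensor_preserves_injective_linearMap _ D.injective_subtype
    have h1 : D.subtype.rTensor k ∘ₗ
        (Coalgebra.counit (R := k) (A := C) ∘ₗ D.subtype).lTensor D =
        (Coalgebra.counit (R := k) (A := C)).lTensor C ∘ₗ TensorProduct.mapIncl D D :=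
      TensorProduct.ext' fun _ _ => rfl
    ext d
    apply hinj
    have a1 := LinearMap.congr_fun h1 (hD.comul d)
    have a3 := LinearMap.congr_fun key d
    simp only [LinearMap.comp_apply, Submodule.coe_subtype] at a1 a3 ⊢
    rw [a1, a3, Coalgebra.lTensor_counit_comul]
    rfl

end SubcoalgebraStructure

/-- A Hopf subalgebra: a subalgebra which is a subcoalgebra and is stable under the antipode. -/
structure HopfSubalgebra (k : Type*) [Field k] (H : Type*) [Ring H] [HopfAlgebra k H] extends
    Subalgebra k H where
  isSubcoalgebra : IsSubcoalgebra k (Subalgebra.toSubmodule toSubalgebra)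
  antipode_mem : ∀ a ∈ toSubalgebra, HopfAlgebra.antipode k a ∈ toSubalgebra

noncomputable instance HopfSubalgebra.instCoalgebra {k : Type*} [Field k] {H : Type*} [Ring H]
    [HopfAlgebra k H] (K : HopfSubalgebra k H) : Coalgebra k K.toSubalgebra :=
  K.isSubcoalgebra.coalgebra

/-- `K₍ₙ₎`, the `n`-th term of the coradical filtration of the coalgebra `K`, seen as a subspace
of `H`. -/
noncomputable def HopfSubalgebra.filtration {k : Type*} [Field k] {H : Type*} [Ring H]
    [HopfAlgebra k H] (K : HopfSubalgebra k H) (n : ℕ) : Submodule k H :=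
  (coradicalFiltration k K.toSubalgebra n).map K.toSubalgebra.val.toLinearMap

/-- A Hopf algebra is connected if its coradical is one-dimensional. -/
def IsConnectedHopfAlgebra (k : Type*) [Field k] (H : Type*) [Ring H] [HopfAlgebra k H] : Prop :=
  Module.finrank k (coradical k H) = 1

/-- The Gelfand-Kirillov dimension of a nonzero algebra `A`: the supremum, over all
finite-dimensional subspaces `V`, of `limsup log_n dim (V⁰ + V¹ + ⋯ + Vⁿ)` as `n → ∞`. -/
noncomputable def gkdim (k : Type*) [Field k] (A : Type*) [Ring A] [Algebra k A] : ℝ≥0∞ :=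
  ⨆ (V : Submodule k A) (_ : FiniteDimensional k V),
    Filter.limsup
      (fun n : ℕ => ENNReal.ofReal
        (Real.logb n (Module.finrank k (∑ i ∈ Finset.range (n + 1), V ^ i : Submodule k A))))
      Filter.atTop

section FilterBasis

variable {k : Type*} [Field k] {H : Type*} [Ring H] [HopfAlgebra k H]

/-- A filter basis of `H` as a left `K`-module: a basis `(aᵢ)` of the left `K`-module `H` with
`H₍ₙ₎ = ∑ᵢ K₍ₙ₋ᵨ₍ₐᵢ₎₎ aᵢ` for all `n ≥ 0`, where `K₍ₘ₎ = 0` for `m < 0`. -/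
structure IsLeftFilterBasis (K : HopfSubalgebra k H) {I : Type*} (a : I → H) : Prop where
  linearIndependent : LinearIndependent K.toSubalgebra a
  span_eq_top : Submodule.span K.toSubalgebra (Set.range a) = ⊤
  filtration_eq : ∀ n : ℕ, coradicalFiltration k H n =
    ⨆ (i : I) (_ : coradicalDegree k (a i) ≤ n),
      (K.filtration (n - coradicalDegree k (a i))).map (LinearMap.mulRight k (a i))

/-- A filter basis of `H` as a right `K`-module: a basis `(aᵢ)` of the right `K`-module `H` with
`H₍ₙ₎ = ∑ᵢ aᵢ K₍ₙ₋ᵨ₍ₐᵢ₎₎` for all `n ≥ 0`, where `K₍ₘ₎ = 0` for `m < 0`.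
Right `K`-modules are modules over the opposite algebra of `K`, and `Hᵐᵒᵖ` acts on `H` by right
multiplication. -/
structure IsRightFilterBasis (K : HopfSubalgebra k H) {I : Type*} (a : I → H) : Prop where
  linearIndependent : LinearIndependent K.toSubalgebra.op a
  span_eq_top : Submodule.span K.toSubalgebra.op (Set.range a) = ⊤
  filtration_eq : ∀ n : ℕ, coradicalFiltration k H n =
    ⨆ (i : I) (_ : coradicalDegree k (a i) ≤ n),
      (K.filtration (n - coradicalDegree k (a i))).map (LinearMap.mulLeft k (a i))

end FilterBasis

/-- The family of nondecreasing products `x_{γ₁} ⋯ x_{γₙ}`, `n ≥ 0`, `γ₁ ≤ ⋯ ≤ γₙ`, indexed by the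
nondecreasing finite sequences in `Γ`. -/
def orderedMonomial {Γ : Type*} [LinearOrder Γ] {H : Type*} [Monoid H] (x : Γ → H)
    (w : {l : List Γ // l.Pairwise (· ≤ ·)}) : H :=
  (w.1.map x).prod

/-! Write F_n for the coradical filtration of H, with F_n = 0 for n < 0. Connectedness makes F_0 the
line spanned by 1, and a comparison of Δ(a) with 1 ⊗ a shows that F is an exhaustive algebra
filtration whose commutators drop one extra degree (`intFiltration_mul_mem`,
`intFiltration_comm_mem`). So gr H is commutative, and the heart of the theorem is that in
characteristic zero it is a polynomial ring over gr K. The proof constructs the partial derivatives.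

For a functional f let D_f(a) = f(a₁)a₂. If f vanishes on F_(d-1) and on all products F_p F_q with p
+ q = d and p, q > 0, then D_f lowers degrees by d and is a derivation up to terms of lower degree
(`lact_mul_sub_mem`); if f also vanishes on K, then D_f kills K. In each degree d choose elements
that form a basis of F_d modulo F_(d-1), decomposables and K, together with dual functionals of this
kind (`exists_isPolynomialSystem`). On monomials in generators of degree at most d_γ, the operator
D_γ is ∂/∂x_γ up to lower degree.

Differentiating a relation by a generator of largest degree gives a relation of smaller degree, and
the multiplicities that appear are invertible; this is independence (`coeff_mem`). Spanning follows
by induction on the degree (`le_monomialSpan`), and the right-handed versions follow because moving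
a coefficient across a monomial only costs lower-degree terms.

For the dimension formula, the same construction for K over k gives generators y of K. The products
of ordered y-monomials and ordered x-monomials form a k-basis of H adapted to F, and counting
exponents identifies the Gelfand–Kirillov dimension with the number of generators (`gkdim_eq_card`),
for K and for H alike. -/

/-! ### Membership in subspaces of a tensor product, tested by contractions -/

section TensorMembership

variable {k : Type*} [Field k] {M N : Type*} [AddCommGroup M] [Module k M]
  [AddCommGroup N] [Module k N]

/-- Contraction of the left tensor factor against a functional. -/
noncomputable def contractFst (f : M →ₗ[k] k) : M ⊗[k] N →ₗ[k] N :=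
  (TensorProduct.lid k N).toLinearMap ∘ₗ f.rTensor N

/-- Contraction of the right tensor factor against a functional. -/
noncomputable def contractSnd (g : N →ₗ[k] k) : M ⊗[k] N →ₗ[k] M :=
  (TensorProduct.rid k M).toLinearMap ∘ₗ g.lTensor M

@[simp]
theorem contractFst_tmul (f : M →ₗ[k] k) (x : M) (y : N) : contractFst f (x ⊗ₜ y) = f x • y := by
  simp [contractFst]

@[simp]
theorem contractSnd_tmul (g : N →ₗ[k] k) (x : M) (y : N) : contractSnd g (x ⊗ₜ y) = g y • x := by
  simp [contractSnd]

theorem contractFst_rTensor {M' : Type*} [AddCommGroup M'] [Module k M'] (f : M →ₗ[k] k)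
    (e : M' →ₗ[k] M) (t : M' ⊗[k] N) :
    contractFst f (e.rTensor N t) = contractFst (f ∘ₗ e) t := by
  induction t with
  | zero => simp
  | tmul x y => simp
  | add x y hx hy => simp [hx, hy]

theorem contractFst_lTensor {N' : Type*} [AddCommGroup N'] [Module k N'] (f : M →ₗ[k] k)
    (e : N →ₗ[k] N') (t : M ⊗[k] N) :
    contractFst f (e.lTensor M t) = e (contractFst f t) := by
  induction t with
  | zero => simp
  | tmul x y => simp
  | add x y hx hy => simp [hx, hy]

theorem contractSnd_rTensor {M' : Type*} [AddCommGroup M'] [Module k M'] (g : N →ₗ[k] k)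
    (e : M →ₗ[k] M') (t : M ⊗[k] N) :
    contractSnd g (e.rTensor N t) = e (contractSnd g t) := by
  induction t with
  | zero => simp
  | tmul x y => simp
  | add x y hx hy => simp [hx, hy]

theorem apply_contractFst (f : M →ₗ[k] k) (g : N →ₗ[k] k) (t : M ⊗[k] N) :
    g (contractFst f t) = f (contractSnd g t) := by
  induction t with
  | zero => simp
  | tmul x y => simp [mul_comm]
  | add x y hx hy => simp [hx, hy]

theorem tmul_mem_range_mapIncl {D : Submodule k M} {E : Submodule k N} {x : M} {y : N}
    (hx : x ∈ D) (hy : y ∈ E) : x ⊗ₜ[k] y ∈ LinearMap.range (TensorProduct.mapIncl D E) :=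
  ⟨⟨x, hx⟩ ⊗ₜ ⟨y, hy⟩, rfl⟩

theorem range_mapIncl_induction {D : Submodule k M} {E : Submodule k N}
    {P : Submodule k (M ⊗[k] N)} (h : ∀ x ∈ D, ∀ y ∈ E, x ⊗ₜ[k] y ∈ P) :
    LinearMap.range (TensorProduct.mapIncl D E) ≤ P := by
  rintro _ ⟨t, rfl⟩
  induction t with
  | zero => simp
  | tmul x y => exact h _ x.2 _ y.2
  | add x y hx hy => rw [map_add]; exact P.add_mem hx hy

theorem contractFst_mem {D : Submodule k M} {E : Submodule k N} {t : M ⊗[k] N}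
    (ht : t ∈ LinearMap.range (TensorProduct.mapIncl D E)) (f : M →ₗ[k] k) :
    contractFst f t ∈ E := by
  have : LinearMap.range (TensorProduct.mapIncl D E) ≤ E.comap (contractFst f) :=
    range_mapIncl_induction fun x _ y hy => by simpa using E.smul_mem _ hy
  exact this ht

theorem contractSnd_mem {D : Submodule k M} {E : Submodule k N} {t : M ⊗[k] N}
    (ht : t ∈ LinearMap.range (TensorProduct.mapIncl D E)) (g : N →ₗ[k] k) :
    contractSnd g t ∈ D := by
  have : LinearMap.range (TensorProduct.mapIncl D E) ≤ D.comap (contractSnd g) :=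
    range_mapIncl_induction fun x hx y _ => by simpa using D.smul_mem _ hx
  exact this ht

theorem exists_projection (D : Submodule k M) :
    ∃ e : M →ₗ[k] M, (∀ x, e x ∈ D) ∧ ∀ x ∈ D, e x = x := by
  obtain ⟨p, hp⟩ := D.subtype.exists_leftInverse_of_injective D.ker_subtype
  exact ⟨D.subtype ∘ₗ p, fun x => (p x).2, fun x hx =>
    congrArg Subtype.val (LinearMap.congr_fun hp ⟨x, hx⟩)⟩

/-- In a basis of the left factor, the coefficients of `t` are its contractions against the
coordinate functionals. This turns inclusions of tensors into statements about functionals, the form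
used throughout. -/
theorem mem_range_mapIncl_top_iff {E : Submodule k N} {t : M ⊗[k] N} :
    t ∈ LinearMap.range (TensorProduct.mapIncl (⊤ : Submodule k M) E) ↔
      ∀ f : M →ₗ[k] k, contractFst f t ∈ E := by
  classical
  refine ⟨fun ht f => contractFst_mem ht f, fun h => ?_⟩
  let b := Module.Basis.ofVectorSpace k M
  let φ := TensorProduct.equivFinsuppOfBasisLeft (N := N) b
  have key : ∀ i, φ t i = contractFst (b.coord i) t := by
    intro i
    clear h
    induction t with
    | zero => simp
    | tmul x y => simp [φ]
    | add x y hx hy => simp [hx, hy]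
  have : t = (φ t).sum fun i n => b i ⊗ₜ n := by
    rw [← TensorProduct.equivFinsuppOfBasisLeft_symm_apply, LinearEquiv.symm_apply_apply]
  rw [this]
  refine Submodule.sum_mem _ fun i _ => tmul_mem_range_mapIncl trivial ?_
  rw [key]
  exact h _

theorem rTensor_mem {D : Submodule k M} {E : Submodule k N} {t : M ⊗[k] N} {D' : Submodule k M}
    (ht : t ∈ LinearMap.range (TensorProduct.mapIncl D E)) {e : M →ₗ[k] M}
    (he : ∀ x ∈ D, e x ∈ D') :
    e.rTensor N t ∈ LinearMap.range (TensorProduct.mapIncl D' E) := by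
  have : LinearMap.range (TensorProduct.mapIncl D E) ≤
      (LinearMap.range (TensorProduct.mapIncl D' E)).comap (e.rTensor N) :=
    range_mapIncl_induction fun x hx y hy => tmul_mem_range_mapIncl (he _ hx) hy
  exact this ht

theorem lTensor_mem {D : Submodule k M} {E : Submodule k N} {t : M ⊗[k] N} {E' : Submodule k N}
    (ht : t ∈ LinearMap.range (TensorProduct.mapIncl D E)) {e : N →ₗ[k] N}
    (he : ∀ x ∈ E, e x ∈ E') :
    e.lTensor M t ∈ LinearMap.range (TensorProduct.mapIncl D E') := by
  have : LinearMap.range (TensorProduct.mapIncl D E) ≤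
      (LinearMap.range (TensorProduct.mapIncl D E')).comap (e.lTensor M) :=
    range_mapIncl_induction fun x hx y hy => tmul_mem_range_mapIncl hx (he _ hy)
  exact this ht

theorem lTensor_eq_self {E : Submodule k N} {t : M ⊗[k] N}
    (ht : ∀ f : M →ₗ[k] k, contractFst f t ∈ E) {e : N →ₗ[k] N} (he : ∀ x ∈ E, e x = x) :
    e.lTensor M t = t := by
  have : LinearMap.range (TensorProduct.mapIncl (⊤ : Submodule k M) E) ≤
      LinearMap.ker (e.lTensor M - LinearMap.id) :=
    range_mapIncl_induction fun x _ y hy => by simp [he y hy]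
  simpa [sub_eq_zero] using this (mem_range_mapIncl_top_iff.2 ht)

/-- An element in the intersection of `D ⊗ N` and `M ⊗ E` lies in `D ⊗ E`. -/
theorem mem_range_mapIncl_inf {D : Submodule k M} {E : Submodule k N} {t : M ⊗[k] N}
    (h : t ∈ LinearMap.range (TensorProduct.mapIncl D (⊤ : Submodule k N)))
    (h' : ∀ f : M →ₗ[k] k, contractFst f t ∈ E) :
    t ∈ LinearMap.range (TensorProduct.mapIncl D E) := by
  obtain ⟨e, he, he'⟩ := exists_projection E
  rw [← lTensor_eq_self h' he']
  exact lTensor_mem h fun x _ => he x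

theorem mem_range_mapIncl_top_right_iff {D : Submodule k M} {t : M ⊗[k] N} :
    t ∈ LinearMap.range (TensorProduct.mapIncl D (⊤ : Submodule k N)) ↔
      ∀ g : N →ₗ[k] k, contractSnd g t ∈ D := by
  refine ⟨fun ht f => contractSnd_mem ht f, fun h => ?_⟩
  have hc : ∀ t : M ⊗[k] N, ∀ g : N →ₗ[k] k,
      contractFst g (TensorProduct.comm k M N t) = contractSnd g t := by
    intro t g
    induction t with
    | zero => simp
    | tmul x y => simp
    | add x y hx hy => simp [hx, hy]
  have := mem_range_mapIncl_top_iff (M := N) (E := D) (t := TensorProduct.comm k M N t)|>.2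
    fun g => by rw [hc]; exact h g
  have h2 : LinearMap.range (TensorProduct.mapIncl (⊤ : Submodule k N) D) ≤
      (LinearMap.range (TensorProduct.mapIncl D (⊤ : Submodule k N))).comap
        (TensorProduct.comm k N M).toLinearMap :=
    range_mapIncl_induction fun x hx y hy => tmul_mem_range_mapIncl hy hx
  simpa using h2 this

/-- A projection onto `G` splits `t` into a part with left factor in `G` and a part seen only by
functionals that vanish on `G`. The subspace here is the one in the recursive definition of the
coradical filtration. -/
theorem mem_sup_range_mapIncl_iff {G : Submodule k M} {E : Submodule k N} {t : M ⊗[k] N} :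
    t ∈ LinearMap.range (TensorProduct.mapIncl (⊤ : Submodule k M) E) ⊔
        LinearMap.range (TensorProduct.mapIncl G (⊤ : Submodule k N)) ↔
      ∀ f : M →ₗ[k] k, (∀ x ∈ G, f x = 0) → contractFst f t ∈ E := by
  constructor
  · intro ht f hf
    have : LinearMap.range (TensorProduct.mapIncl (⊤ : Submodule k M) E) ⊔
        LinearMap.range (TensorProduct.mapIncl G (⊤ : Submodule k N)) ≤ E.comap (contractFst f) :=
      sup_le (fun s hs => contractFst_mem hs f)
        (range_mapIncl_induction fun x hx y _ => by simp [hf x hx])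
    exact this ht
  · intro h
    obtain ⟨e, he, he'⟩ := exists_projection G
    have hsplit : t = (LinearMap.id - e).rTensor N t + e.rTensor N t := by
      simp [LinearMap.rTensor_sub]
    rw [hsplit]
    refine Submodule.add_mem_sup (mem_range_mapIncl_top_iff.2 fun f => ?_)
      (rTensor_mem (D := ⊤) (mem_range_mapIncl_top_iff.2 fun _ => Submodule.mem_top) fun x _ => he x)
    rw [contractFst_rTensor]
    exact h _ fun x hx => by simp [he' x hx]

/-- If the contractions of `t` against functionals vanishing on `F p` lie in `G p`, for an
increasing exhaustive filtration `F` and a decreasing `G`, then `t ∈ ∑ₚ F (p + 1) ⊗ G p`. -/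
theorem mem_iSup_range_mapIncl {F : ℕ → Submodule k M} (hF : Monotone F) (hF0 : F 0 = ⊥)
    {G : ℕ → Submodule k N} {m : ℕ} {t : M ⊗[k] N}
    (hm : t ∈ LinearMap.range (TensorProduct.mapIncl (F m) (⊤ : Submodule k N)))
    (ht : ∀ p, ∀ f : M →ₗ[k] k, (∀ x ∈ F p, f x = 0) → contractFst f t ∈ G p) :
    t ∈ ⨆ p, LinearMap.range (TensorProduct.mapIncl (F (p + 1)) (G p)) := by
  induction m generalizing t with
  | zero =>
    have : LinearMap.range (TensorProduct.mapIncl (F 0) (⊤ : Submodule k N)) ≤ ⊥ :=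
      range_mapIncl_induction fun x hx y _ => by
        rw [hF0, Submodule.mem_bot] at hx
        simp [hx]
    rw [(Submodule.mem_bot k).1 (this hm)]
    exact Submodule.zero_mem _
  | succ m ih =>
    -- The functionals `f ∘ (1 - e)` vanish on `F m`, so the component of `t` under `1 - e` lies in
    -- `F (m + 1) ⊗ G m`. The remaining component has left factor in `F m` and is left to the
    -- induction.
    obtain ⟨e, he, he'⟩ := exists_projection (F m)
    have hsplit : t = (LinearMap.id - e).rTensor N t + e.rTensor N t := by
      simp [LinearMap.rTensor_sub]
    rw [hsplit]
    refine Submodule.add_mem _ (Submodule.mem_iSup_of_mem m ?_) (ih ?_ ?_)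
    · refine mem_range_mapIncl_inf (rTensor_mem hm fun x hx => ?_) fun f => ?_
      · exact Submodule.sub_mem _ hx (hF (Nat.le_succ m) (he x))
      · rw [contractFst_rTensor]
        exact ht _ _ fun x hx => by simp [he' x hx]
    · exact rTensor_mem hm fun x _ => he x
    · intro p f hf
      rw [contractFst_rTensor]
      by_cases hpm : p ≤ m
      · exact ht p _ fun x hx => by simp [he' x (hF hpm hx), hf x hx]
      · have : f ∘ₗ e = 0 := LinearMap.ext fun x => hf _ (hF (by omega) (he x))
        rw [this, show contractFst (0 : M →ₗ[k] k) t = 0 by simp [contractFst]]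
        exact Submodule.zero_mem _

end TensorMembership

section TensorMembership

variable {k : Type*} [Field k] {M N : Type*} [AddCommGroup M] [Module k M]
  [AddCommGroup N] [Module k N]

theorem eq_of_forall_dual_apply_eq {x y : M} (h : ∀ f : M →ₗ[k] k, f x = f y) : x = y := by
  rw [← sub_eq_zero, ← Module.forall_dual_apply_eq_zero_iff k]
  intro f
  rw [map_sub, h f, sub_self]

theorem exists_finiteDimensional_contractFst (t : M ⊗[k] N) :
    ∃ V : Submodule k N, FiniteDimensional k V ∧ ∀ f : M →ₗ[k] k, contractFst f t ∈ V := by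
  induction t with
  | zero => exact ⟨⊥, inferInstance, fun f => by simp⟩
  | tmul x y =>
    refine ⟨Submodule.span k {y}, inferInstance, fun f => ?_⟩
    rw [contractFst_tmul]
    exact Submodule.smul_mem _ _ (Submodule.mem_span_singleton_self y)
  | add s t hs ht =>
    obtain ⟨V, hV, hV'⟩ := hs
    obtain ⟨W, hW, hW'⟩ := ht
    refine ⟨V ⊔ W, inferInstance, fun f => ?_⟩
    rw [map_add]
    exact Submodule.add_mem_sup (hV' f) (hW' f)

theorem exists_finiteDimensional_contractSnd (t : M ⊗[k] N) :
    ∃ V : Submodule k M, FiniteDimensional k V ∧ ∀ f : N →ₗ[k] k, contractSnd f t ∈ V := by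
  induction t with
  | zero => exact ⟨⊥, inferInstance, fun f => by simp⟩
  | tmul x y =>
    refine ⟨Submodule.span k {x}, inferInstance, fun f => ?_⟩
    rw [contractSnd_tmul]
    exact Submodule.smul_mem _ _ (Submodule.mem_span_singleton_self x)
  | add s t hs ht =>
    obtain ⟨V, hV, hV'⟩ := hs
    obtain ⟨W, hW, hW'⟩ := ht
    refine ⟨V ⊔ W, inferInstance, fun f => ?_⟩
    rw [map_add]
    exact Submodule.add_mem_sup (hV' f) (hW' f)

end TensorMembership

/-! ### The left and right actions of functionals on a coalgebra -/

section CoalgebraActions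

variable {k : Type*} [Field k] {C : Type*} [AddCommGroup C] [Module k C] [Coalgebra k C]

/-- The operator `a ↦ f(a₁) a₂`. -/
noncomputable def lact (f : C →ₗ[k] k) : C →ₗ[k] C := contractFst f ∘ₗ Coalgebra.comul

/-- The operator `a ↦ a₁ g(a₂)`. -/
noncomputable def ract (g : C →ₗ[k] k) : C →ₗ[k] C := contractSnd g ∘ₗ Coalgebra.comul

theorem lact_apply (f : C →ₗ[k] k) (a : C) :
    lact f a = contractFst f (Coalgebra.comul (R := k) a) := rfl

theorem ract_apply (f : C →ₗ[k] k) (a : C) :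
    ract f a = contractSnd f (Coalgebra.comul (R := k) a) := rfl

theorem ract_add (f g : C →ₗ[k] k) (a : C) : ract (f + g) a = ract f a + ract g a := by
  simp [ract_apply, contractSnd, LinearMap.lTensor_add]

theorem lact_add (f g : C →ₗ[k] k) (a : C) : lact (f + g) a = lact f a + lact g a := by
  simp [lact_apply, contractFst, LinearMap.rTensor_add]

theorem ract_smul (c : k) (g : C →ₗ[k] k) (a : C) : ract (c • g) a = c • ract g a := by
  simp [ract_apply, contractSnd, LinearMap.lTensor_smul]

theorem lact_smul (c : k) (g : C →ₗ[k] k) (a : C) : lact (c • g) a = c • lact g a := by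
  simp [lact_apply, contractFst, LinearMap.rTensor_smul]

/-- Both sides are f(a₁)g(a₂). This adjunction transfers every statement about one action to the
other. -/
theorem apply_lact (f g : C →ₗ[k] k) (a : C) : g (lact f a) = f (ract g a) :=
  apply_contractFst f g _

@[simp]
theorem lact_counit (a : C) : lact (Coalgebra.counit (R := k) (A := C)) a = a := by
  simp [lact_apply, contractFst, Coalgebra.rTensor_counit_comul]

@[simp]
theorem ract_counit (a : C) : ract (Coalgebra.counit (R := k) (A := C)) a = a := by
  simp [ract_apply, contractSnd, Coalgebra.lTensor_counit_comul]

theorem comul_ract (g : C →ₗ[k] k) (a : C) :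
    Coalgebra.comul (R := k) (ract g a) = (ract g).lTensor C (Coalgebra.comul (R := k) a) := by
  have h1 : (ract g).lTensor C (Coalgebra.comul (R := k) a) =
      (contractSnd g).lTensor C ((Coalgebra.comul (R := k)).lTensor C
        (Coalgebra.comul (R := k) a)) := by
    rw [ract, LinearMap.lTensor_comp_apply]
  have h2 : ∀ t : (C ⊗[k] C) ⊗[k] C,
      (contractSnd g).lTensor C (TensorProduct.assoc k C C C t) = contractSnd g t := by
    intro t
    have : (contractSnd g).lTensor C ∘ₗ (TensorProduct.assoc k C C C).toLinearMap =
        contractSnd g := by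
      apply TensorProduct.ext_threefold
      intro x y z
      simp
    exact LinearMap.congr_fun this t
  rw [h1, ← Coalgebra.coassoc_apply, h2, contractSnd_rTensor, ract_apply]

theorem lact_ract (f g : C →ₗ[k] k) (a : C) : lact f (ract g a) = ract g (lact f a) := by
  rw [lact_apply, comul_ract, contractFst_lTensor, lact_apply]

theorem lact_mem {D : Submodule k C} (hD : IsSubcoalgebra k D) {a : C} (ha : a ∈ D)
    (f : C →ₗ[k] k) : lact f a ∈ D := contractFst_mem (hD a ha) f

/-- Stability under the right action puts Δ(D) in D ⊗ C, stability under the left action puts it in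
C ⊗ D, and the intersection of these is D ⊗ D. -/
theorem isSubcoalgebra_of_forall_mem {D : Submodule k C}
    (hl : ∀ f : C →ₗ[k] k, ∀ a ∈ D, lact f a ∈ D) (hr : ∀ f : C →ₗ[k] k, ∀ a ∈ D, ract f a ∈ D) :
    IsSubcoalgebra k D := fun a ha =>
  mem_range_mapIncl_inf (mem_range_mapIncl_top_right_iff.2 fun g => hr g a ha)
    fun f => hl f a ha

theorem ract_mem {D : Submodule k C} (hD : IsSubcoalgebra k D) {a : C} (ha : a ∈ D)
    (f : C →ₗ[k] k) : ract f a ∈ D := contractSnd_mem (hD a ha) f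

theorem IsSubcoalgebra.sup {D E : Submodule k C} (hD : IsSubcoalgebra k D)
    (hE : IsSubcoalgebra k E) : IsSubcoalgebra k (D ⊔ E) := by
  refine isSubcoalgebra_of_forall_mem (fun f => ?_) (fun f => ?_)
  · exact show D ⊔ E ≤ (D ⊔ E).comap (lact f) from
      sup_le (fun a ha => Submodule.mem_sup_left (lact_mem hD ha f))
        fun a ha => Submodule.mem_sup_right (lact_mem hE ha f)
  · exact show D ⊔ E ≤ (D ⊔ E).comap (ract f) from
      sup_le (fun a ha => Submodule.mem_sup_left (ract_mem hD ha f))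
        fun a ha => Submodule.mem_sup_right (ract_mem hE ha f)

theorem isSubcoalgebra_span_singleton {g : C}
    (hg : Coalgebra.comul (R := k) g = g ⊗ₜ[k] g) : IsSubcoalgebra k (Submodule.span k {g}) := by
  intro d hd
  obtain ⟨c, rfl⟩ := Submodule.mem_span_singleton.1 hd
  rw [map_smul, hg]
  have hm := Submodule.mem_span_singleton_self (R := k) g
  exact Submodule.smul_mem _ _ (tmul_mem_range_mapIncl hm hm)

/-- The fundamental theorem of coalgebras: every element lies in a finite-dimensional
subcoalgebra. -/
theorem exists_finiteDimensional_subcoalgebra (a : C) :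
    ∃ D : Submodule k C, IsSubcoalgebra k D ∧ FiniteDimensional k D ∧ a ∈ D := by
  classical
  have hlact : ∀ f h : C →ₗ[k] k, ∀ a : C, lact f (lact h a) = lact (h ∘ₗ ract f) a := by
    intro f h a
    refine eq_of_forall_dual_apply_eq (k := k) fun φ => ?_
    rw [apply_lact, ← lact_ract, apply_lact, apply_lact, LinearMap.comp_apply]
  have hract : ∀ f h : C →ₗ[k] k, ∀ a : C, ract f (ract h a) = ract (h ∘ₗ lact f) a := by
    intro f h a
    refine eq_of_forall_dual_apply_eq (k := k) fun φ => ?_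
    rw [← apply_lact, lact_ract, ← apply_lact, ← apply_lact, LinearMap.comp_apply]
  -- The span of all f(a₁)a₂g(a₃). Coassociativity makes it stable under both actions, and f = g = ε
  -- recovers `a`.
  let D : Submodule k C := Submodule.span k (Set.range fun p : (C →ₗ[k] k) × (C →ₗ[k] k) =>
    lact p.1 (ract p.2 a))
  refine ⟨D, isSubcoalgebra_of_forall_mem (fun f => ?_) (fun f => ?_), ?_, ?_⟩
  · refine show D ≤ D.comap (lact f) from Submodule.span_le.2 ?_
    rintro _ ⟨p, rfl⟩
    exact Submodule.subset_span ⟨(p.1 ∘ₗ ract f, p.2), (hlact _ _ _).symm⟩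
  · refine show D ≤ D.comap (ract f) from Submodule.span_le.2 ?_
    rintro _ ⟨p, rfl⟩
    refine Submodule.subset_span ⟨(p.1, p.2 ∘ₗ lact f), ?_⟩
    simp only [← lact_ract, hract]
  -- All right translates of `a` lie in one finite-dimensional `U`. For each of finitely many
  -- generators of `U`, the left translates again fill a finite-dimensional space.
  · obtain ⟨U, hU, hU'⟩ := exists_finiteDimensional_contractSnd (Coalgebra.comul (R := k) a)
    choose V hV hV' using fun x : C =>
      exists_finiteDimensional_contractFst (k := k) (Coalgebra.comul (R := k) x)
    obtain ⟨s, rfl⟩ := Module.Finite.iff_fg.1 hU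
    have hfin : FiniteDimensional k (⨆ x ∈ s, V x : Submodule k C) := by
      rw [iSup_subtype']
      exact Submodule.finiteDimensional_iSup _
    refine Submodule.finiteDimensional_of_le (S₂ := ⨆ x ∈ s, V x) (Submodule.span_le.2 ?_)
    rintro _ ⟨p, rfl⟩
    have : Submodule.span k (s : Set C) ≤ (⨆ x ∈ s, V x).comap (lact p.1) :=
      Submodule.span_le.2 fun x hx =>
        Submodule.mem_iSup_of_mem x (Submodule.mem_iSup_of_mem hx (hV' x p.1))
    exact this (hU' p.2)
  · exact Submodule.subset_span ⟨(Coalgebra.counit, Coalgebra.counit), by simp⟩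

end CoalgebraActions

/-! ### Nilpotency of a largest proper two-sided ideal in an Artinian ring -/

/-- In an Artinian ring, a proper two-sided ideal containing every proper two-sided ideal is
nilpotent. -/
theorem isNilpotent_of_forall_isTwoSided_le {R : Type*} [Ring R] [IsArtinianRing R] (J : Ideal R)
    [J.IsTwoSided] (hJ : J ≠ ⊤) (h : ∀ I : Ideal R, I.IsTwoSided → I ≠ ⊤ → I ≤ J) :
    IsNilpotent J := by
  suffices hle : J ≤ Ring.jacobson R by
    obtain ⟨n, hn⟩ := IsArtinianRing.isNilpotent_jacobson_bot (R := R)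
    refine ⟨n, le_bot_iff.1 (le_trans (Ideal.pow_right_mono ?_ n) hn.le)⟩
    rwa [Ideal.jacobson_bot]
  have : Nontrivial R := by
    by_contra hR
    rw [not_nontrivial_iff_subsingleton] at hR
    exact hJ (Subsingleton.elim _ _)
  have hjac : Ring.jacobson R ≤ J := h _ inferInstance (Ring.jacobson_lt_top R).ne
  -- In the semisimple quotient the image of `J` is generated by an idempotent `e`. It remains to
  -- see that `e` is central, since a central idempotent other than 0 and 1 would give a proper
  -- two-sided ideal not contained in `J`.
  let Q := R ⧸ Ring.jacobson R
  let π : R →+* Q := Ideal.Quotient.mk _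
  have hπ : Function.Surjective π := Ideal.Quotient.mk_surjective
  have hss : IsSemisimpleRing Q := IsArtinianRing.isSemisimpleRing_iff_jacobson.2
    (Ring.jacobson_quotient_jacobson R)
  have hsemiprime : ∀ a : Q, (∀ x, a * x * a = 0) → a = 0 := by
    intro a ha
    obtain ⟨e, he, hae⟩ := IsSemisimpleRing.ideal_eq_span_idempotent (Ideal.span {a})
    obtain ⟨q, hq⟩ := Ideal.mem_span_singleton'.1
      (hae ▸ Ideal.mem_span_singleton_self e : e ∈ Ideal.span {a})
    obtain ⟨r, hr⟩ := Ideal.mem_span_singleton'.1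
      (hae ▸ Ideal.mem_span_singleton_self a : a ∈ Ideal.span {e})
    have : e = 0 := by
      rw [← he.eq, ← hq, show q * a * (q * a) = q * (a * q * a) by noncomm_ring, ha, mul_zero]
    rw [← hr, this, mul_zero]
  obtain ⟨e, he, hJe⟩ := IsSemisimpleRing.ideal_eq_span_idempotent (J.map π)
  have hmem : ∀ x, π x ∈ J.map π ↔ x ∈ J := by
    intro x
    rw [Ideal.mem_map_iff_of_surjective π hπ]
    refine ⟨?_, fun hx => ⟨x, hx, rfl⟩⟩
    rintro ⟨y, hy, hxy⟩
    have := hjac (Ideal.Quotient.eq.1 hxy)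
    simpa using J.sub_mem hy this
  have hmul : ∀ x ∈ J.map π, x * e = x := by
    intro x hx
    rw [hJe] at hx
    obtain ⟨y, rfl⟩ := Ideal.mem_span_singleton'.1 hx
    rw [mul_assoc, he.eq]
  have heJ : e ∈ J.map π := hJe ▸ Ideal.mem_span_singleton_self e
  have hright : ∀ q, e * q ∈ J.map π := by
    intro q
    obtain ⟨x, rfl⟩ := hπ q
    obtain ⟨y, rfl⟩ := hπ e
    rw [← map_mul, hmem]
    exact J.mul_mem_right _ ((hmem y).1 heJ)
  have hcomm : ∀ q, q * e = e * q := by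
    intro q
    -- With u = qe - eqe one has u x u = 0 for all x, because `ex` lies in the image of `J`, on
    -- which `e` is a right identity.
    have h0 : q * e - e * q * e = 0 := hsemiprime _ fun x => by
      have h1 := hmul _ (hright x)
      calc (q * e - e * q * e) * x * (q * e - e * q * e)
          = (q - e * q) * ((e * x) * (q * e) - (e * x * e) * (q * e)) := by
            simp only [sub_mul, mul_sub, mul_assoc]
        _ = 0 := by rw [h1]; simp
    rw [sub_eq_zero.1 h0, hmul _ (hright q)]
  -- The preimage of the annihilator of `e`. If it is proper it lies in `J`, which forces 1 - e = 0
  -- and `J = ⊤`; otherwise e = 0 and `J` lies in the radical.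
  let I : Ideal R :=
    { carrier := {x | π x * e = 0}
      add_mem' := fun {x y} hx hy => by
        simp only [Set.mem_ofPred_eq] at hx hy ⊢
        rw [map_add, add_mul, hx, hy, add_zero]
      zero_mem' := by simp
      smul_mem' := fun c x hx => by
        simp only [Set.mem_ofPred_eq] at hx ⊢
        rw [smul_eq_mul, map_mul, mul_assoc, hx, mul_zero] }
  have hI : I.IsTwoSided := ⟨fun {x} b hx => by
    change π x * e = 0 at hx
    change π (x * b) * e = 0
    rw [map_mul, mul_assoc, hcomm, ← mul_assoc, hx, zero_mul]⟩
  by_cases hItop : I = ⊤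
  · have h1 : (1 : R) ∈ I := hItop ▸ Submodule.mem_top
    change π 1 * e = 0 at h1
    rw [map_one, one_mul] at h1
    intro x hx
    have := hmul _ ((hmem x).2 hx)
    rw [h1, mul_zero] at this
    exact Ideal.Quotient.eq_zero_iff_mem.1 this.symm
  · exfalso
    obtain ⟨y, hy⟩ := hπ (1 - e)
    have hyI : y ∈ I := by
      change π y * e = 0
      rw [hy, sub_mul, one_mul, he.eq, sub_self]
    have h1 := hmul _ ((hmem y).2 (h I hI hItop hyI))
    rw [hy, sub_mul, one_mul, he.eq, sub_self] at h1
    apply hJ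
    rw [Ideal.eq_top_iff_one, ← hmem, map_one]
    rw [← sub_eq_zero.1 h1.symm] at heJ
    exact heJ

/-! ### The coradical filtration when the coradical is spanned by one group-like element -/

section CoradicalFiltration

variable {k : Type*} [Field k] {C : Type*} [AddCommGroup C] [Module k C]

theorem mem_span_singleton_of_forall_dual {g a : C}
    (h : ∀ f : C →ₗ[k] k, f g = 0 → f a = 0) : a ∈ Submodule.span k {g} := by
  by_contra ha
  obtain ⟨f, hf, hf'⟩ := Submodule.exists_dual_map_eq_bot_of_notMem ha inferInstance
  refine hf (h f ?_)
  rw [← Submodule.mem_bot k, ← hf']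
  exact Submodule.mem_map_of_mem (Submodule.mem_span_singleton_self g)

theorem eq_zero_of_mem_span_singleton {g a : C} (ha : a ∈ Submodule.span k {g}) {f : C →ₗ[k] k}
    (hf : f g = 0) : f a = 0 := by
  obtain ⟨c, rfl⟩ := Submodule.mem_span_singleton.1 ha
  simp [hf]

variable [Coalgebra k C] {g : C}

theorem mem_coradicalFiltration_succ (hg : coradical k C = Submodule.span k {g}) {n : ℕ} {a : C} :
    a ∈ coradicalFiltration k C (n + 1) ↔
      ∀ f : C →ₗ[k] k, f g = 0 → lact f a ∈ coradicalFiltration k C n := by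
  rw [coradicalFiltration, Submodule.mem_comap, mem_sup_range_mapIncl_iff, hg]
  refine forall_congr' fun f => imp_congr ⟨fun h => ?_, fun h x hx => ?_⟩ Iff.rfl
  · exact h _ (Submodule.mem_span_singleton_self g)
  · exact eq_zero_of_mem_span_singleton hx h

/-- The definition of the filtration is one-sided, but the result is symmetric. In the lowest degree
this is the adjunction between the two actions; further up it follows because the actions commute.
-/
theorem mem_coradicalFiltration_succ' (hg : coradical k C = Submodule.span k {g}) {n : ℕ} {a : C} :
    a ∈ coradicalFiltration k C (n + 1) ↔
      ∀ f : C →ₗ[k] k, f g = 0 → ract f a ∈ coradicalFiltration k C n := by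
  induction n generalizing a with
  | zero =>
    rw [mem_coradicalFiltration_succ hg, coradicalFiltration, hg]
    constructor
    · intro h f hf
      refine mem_span_singleton_of_forall_dual fun φ hφ => ?_
      rw [← apply_lact]
      exact eq_zero_of_mem_span_singleton (h φ hφ) hf
    · intro h f hf
      refine mem_span_singleton_of_forall_dual fun φ hφ => ?_
      rw [apply_lact]
      exact eq_zero_of_mem_span_singleton (h φ hφ) hf
  | succ n ih =>
    rw [mem_coradicalFiltration_succ hg]
    constructor
    · intro h f hf
      rw [mem_coradicalFiltration_succ hg]
      intro φ hφ
      rw [lact_ract]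
      exact ih.1 (h φ hφ) f hf
    · intro h f hf
      rw [ih]
      intro φ hφ
      rw [← lact_ract]
      exact (mem_coradicalFiltration_succ hg).1 (h φ hφ) f hf

theorem lact_groupLike (hΔ : IsGroupLikeElem k g) (f : C →ₗ[k] k) : lact f g = f g • g := by
  rw [lact_apply, hΔ.comul_eq_tmul_self, contractFst_tmul]

theorem ract_groupLike (hΔ : IsGroupLikeElem k g) (f : C →ₗ[k] k) : ract f g = f g • g := by
  rw [ract_apply, hΔ.comul_eq_tmul_self, contractSnd_tmul]

theorem coradicalFiltration_mono (hg : coradical k C = Submodule.span k {g})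
    (hΔ : IsGroupLikeElem k g) : Monotone (coradicalFiltration k C) := by
  refine monotone_nat_of_le_succ fun n => ?_
  induction n with
  | zero =>
    intro a ha
    rw [mem_coradicalFiltration_succ hg]
    intro f hf
    rw [coradicalFiltration, hg] at ha
    obtain ⟨c, rfl⟩ := Submodule.mem_span_singleton.1 ha
    rw [map_smul, lact_groupLike hΔ, hf, zero_smul, smul_zero]
    exact Submodule.zero_mem _
  | succ n ih =>
    intro a ha
    rw [mem_coradicalFiltration_succ hg] at ha ⊢
    exact fun f hf => ih (ha f hf)

theorem ract_mem_coradicalFiltration (hg : coradical k C = Submodule.span k {g})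
    (hΔ : IsGroupLikeElem k g) {n : ℕ} {a : C} (ha : a ∈ coradicalFiltration k C n)
    (f : C →ₗ[k] k) : ract f a ∈ coradicalFiltration k C n := by
  -- Since ε(g) = 1, every functional is a multiple of ε plus one vanishing at `g`; the first part
  -- acts by a scalar and the second lowers the degree.
  have hsplit : ract f a = f g • a + ract (f - f g • Coalgebra.counit) a := by
    conv_lhs => rw [← sub_add_cancel f (f g • Coalgebra.counit), ract_add, ract_smul, ract_counit]
    rw [add_comm]
  have hf : (f - f g • Coalgebra.counit : C →ₗ[k] k) g = 0 := by
    simp [hΔ.counit_eq_one]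
  cases n with
  | zero =>
    rw [coradicalFiltration, hg] at ha ⊢
    obtain ⟨c, rfl⟩ := Submodule.mem_span_singleton.1 ha
    rw [map_smul, ract_groupLike hΔ, smul_smul]
    exact Submodule.smul_mem _ _ (Submodule.mem_span_singleton_self g)
  | succ n =>
    rw [hsplit]
    exact Submodule.add_mem _ (Submodule.smul_mem _ _ ha)
      (coradicalFiltration_mono hg hΔ n.le_succ ((mem_coradicalFiltration_succ' hg).1 ha _ hf))

variable (k C) in
/-- The coradical filtration indexed by the integers, zero in negative degrees. -/
noncomputable def intFiltration : ℤ → Submodule k C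
  | Int.ofNat n => coradicalFiltration k C n
  | Int.negSucc _ => ⊥

theorem intFiltration_natCast (n : ℕ) : intFiltration k C n = coradicalFiltration k C n := rfl

theorem intFiltration_of_neg {n : ℤ} (hn : n < 0) : intFiltration k C n = ⊥ := by
  obtain ⟨m, rfl⟩ := Int.eq_negSucc_of_lt_zero hn
  rfl

theorem intFiltration_zero (hg : coradical k C = Submodule.span k {g}) :
    intFiltration k C 0 = Submodule.span k {g} := hg

theorem intFiltration_mono (hg : coradical k C = Submodule.span k {g})
    (hΔ : IsGroupLikeElem k g) : Monotone (intFiltration k C) := by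
  intro m n hmn
  rcases lt_or_ge m 0 with hm | hm
  · rw [intFiltration_of_neg hm]
    exact bot_le
  · lift m to ℕ using hm
    lift n to ℕ using (by omega)
    exact coradicalFiltration_mono hg hΔ (by exact_mod_cast hmn)

theorem mem_intFiltration (hg : coradical k C = Submodule.span k {g}) {n : ℤ} (hn : 0 < n)
    {a : C} : a ∈ intFiltration k C n ↔
      ∀ f : C →ₗ[k] k, f g = 0 → lact f a ∈ intFiltration k C (n - 1) := by
  obtain ⟨m, rfl⟩ : ∃ m : ℕ, n = (m + 1 : ℕ) := ⟨(n - 1).toNat, by omega⟩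
  rw [intFiltration_natCast, mem_coradicalFiltration_succ hg,
    show ((m + 1 : ℕ) : ℤ) - 1 = (m : ℕ) by push_cast; ring, intFiltration_natCast]

theorem ract_mem_intFiltration_pred (hg : coradical k C = Submodule.span k {g})
    (hΔ : IsGroupLikeElem k g) {n : ℤ} {a : C} (ha : a ∈ intFiltration k C n)
    {f : C →ₗ[k] k} (hf : f g = 0) : ract f a ∈ intFiltration k C (n - 1) := by
  rcases lt_trichotomy n 0 with hn | rfl | hn
  · rw [intFiltration_of_neg hn, Submodule.mem_bot] at ha
    rw [ha, map_zero]
    exact Submodule.zero_mem _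
  · rw [intFiltration_zero hg] at ha
    obtain ⟨c, rfl⟩ := Submodule.mem_span_singleton.1 ha
    rw [map_smul, ract_groupLike hΔ, hf, zero_smul, smul_zero]
    exact Submodule.zero_mem _
  · obtain ⟨m, rfl⟩ : ∃ m : ℕ, n = (m + 1 : ℕ) := ⟨(n - 1).toNat, by omega⟩
    rw [show ((m + 1 : ℕ) : ℤ) - 1 = (m : ℕ) by push_cast; ring]
    exact (mem_coradicalFiltration_succ' hg).1 ha f hf

theorem ract_mem_intFiltration (hg : coradical k C = Submodule.span k {g})
    (hΔ : IsGroupLikeElem k g) {n : ℤ} {a : C} (ha : a ∈ intFiltration k C n)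
    (f : C →ₗ[k] k) : ract f a ∈ intFiltration k C n := by
  rcases lt_or_ge n 0 with hn | hn
  · rw [intFiltration_of_neg hn, Submodule.mem_bot] at ha
    rw [ha, map_zero]
    exact Submodule.zero_mem _
  · lift n to ℕ using hn
    exact ract_mem_coradicalFiltration hg hΔ ha f

/-- A functional vanishing in degrees `< p` lowers the coradical degree by `p`. -/
theorem lact_mem_intFiltration_sub (hg : coradical k C = Submodule.span k {g})
    (hΔ : IsGroupLikeElem k g) {p : ℤ} {f : C →ₗ[k] k}
    (hf : ∀ x ∈ intFiltration k C (p - 1), f x = 0) {n : ℤ} {a : C}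
    (ha : a ∈ intFiltration k C n) : lact f a ∈ intFiltration k C (n - p) := by
  rcases lt_or_ge n p with hnp | hnp
  -- By adjunction, any φ applied to `lact f a` is `f` applied to a right translate of `a`, which
  -- stays in degree n ≤ p - 1, where `f` vanishes.
  · rw [intFiltration_of_neg (by omega), Submodule.mem_bot]
    refine eq_of_forall_dual_apply_eq (k := k) fun φ => ?_
    rw [apply_lact, map_zero]
    exact hf _ (ract_mem_intFiltration hg hΔ (intFiltration_mono hg hΔ (by omega) ha) φ)
  -- Induction on n - p: right translation by φ with φ(g) = 0 lowers the degree of `a` by one and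
  -- commutes with `lact f`.
  · obtain ⟨m, hm⟩ : ∃ m : ℕ, n = p + m := ⟨(n - p).toNat, by omega⟩
    induction m generalizing n a with
    | zero =>
      have : n - p = 0 := by omega
      rw [this, intFiltration_zero hg]
      refine mem_span_singleton_of_forall_dual fun φ hφ => ?_
      rw [apply_lact]
      refine hf _ ?_
      have := ract_mem_intFiltration_pred hg hΔ ha hφ
      rwa [show n - 1 = p - 1 by omega] at this
    | succ m ih =>
      obtain ⟨q, hq⟩ : ∃ q : ℕ, n - p = (q + 1 : ℕ) := ⟨m, by omega⟩
      rw [hq, intFiltration_natCast, mem_coradicalFiltration_succ' hg]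
      intro φ hφ
      rw [← lact_ract]
      have := ih (ract_mem_intFiltration_pred hg hΔ ha hφ) (by omega) (by push_cast at hm ⊢; omega)
      rwa [show n - 1 - p = (q : ℕ) by push_cast at hq; omega] at this

end CoradicalFiltration

/-! ### Simple subcoalgebras and injective coalgebra maps -/

section SimpleSubcoalgebras

variable {k : Type*} [Field k] {C : Type*} [AddCommGroup C] [Module k C] [Coalgebra k C] {g : C}

theorem isSimpleSubcoalgebra_span_singleton (hΔ : IsGroupLikeElem k g) :
    IsSimpleSubcoalgebra k (Submodule.span k {g}) := by
  have hg0 : g ≠ 0 := by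
    rintro rfl
    simpa using hΔ.counit_eq_one
  refine ⟨isSubcoalgebra_span_singleton hΔ.comul_eq_tmul_self, by simpa using hg0, ?_⟩
  intro E hE _
  exact (nonzero_span_atom g hg0).le_iff.1 hE

theorem exists_isSimpleSubcoalgebra_le {D : Submodule k C} [FiniteDimensional k D]
    (hD : IsSubcoalgebra k D) (hD0 : D ≠ ⊥) : ∃ E ≤ D, IsSimpleSubcoalgebra k E := by
  obtain ⟨n, hn⟩ : ∃ n, Module.finrank k D = n := ⟨_, rfl⟩
  induction n using Nat.strong_induction_on generalizing D with
  | _ n ih =>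
    by_cases hs : IsSimpleSubcoalgebra k D
    · exact ⟨D, le_rfl, hs⟩
    · rw [IsSimpleSubcoalgebra] at hs
      push Not at hs
      obtain ⟨E, hED, hE, hE0, hne⟩ := hs hD hD0
      have : FiniteDimensional k E := Submodule.finiteDimensional_of_le hED
      obtain ⟨F, hF, hF'⟩ := ih _ (hn ▸ Submodule.finrank_lt_finrank_of_lt (hED.lt_of_ne hne))
        hE hE0 rfl
      exact ⟨F, hF.trans hED, hF'⟩

variable {C' : Type*} [AddCommGroup C'] [Module k C'] [Coalgebra k C'] (ι : C →ₗc[k] C')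

theorem apply_lact_comp (f : C' →ₗ[k] k) (a : C) :
    ι (lact (f ∘ₗ ι.toLinearMap) a) = lact f (ι a) := by
  rw [lact_apply, lact_apply, ← CoalgHomClass.map_comp_comul_apply]
  generalize Coalgebra.comul (R := k) a = t
  induction t with
  | zero => simp
  | tmul x y => simp
  | add x y hx hy => simp only [map_add, hx, hy]

theorem apply_ract_comp (f : C' →ₗ[k] k) (a : C) :
    ι (ract (f ∘ₗ ι.toLinearMap) a) = ract f (ι a) := by
  rw [ract_apply, ract_apply, ← CoalgHomClass.map_comp_comul_apply]
  generalize Coalgebra.comul (R := k) a = t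
  induction t with
  | zero => simp
  | tmul x y => simp
  | add x y hx hy => simp only [map_add, hx, hy]

theorem exists_dual_comp_eq {ι : C →ₗc[k] C'} (hι : Function.Injective ι) (f : C →ₗ[k] k) :
    ∃ f' : C' →ₗ[k] k, f' ∘ₗ ι.toLinearMap = f := by
  obtain ⟨p, hp⟩ := ι.toLinearMap.exists_leftInverse_of_injective
    (LinearMap.ker_eq_bot.2 hι)
  exact ⟨f ∘ₗ p, by rw [LinearMap.comp_assoc, hp, LinearMap.comp_id]⟩

theorem IsSubcoalgebra.map {D : Submodule k C} (hD : IsSubcoalgebra k D) :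
    IsSubcoalgebra k (D.map ι.toLinearMap) := by
  refine isSubcoalgebra_of_forall_mem (fun f => ?_) (fun f => ?_)
  · rintro _ ⟨a, ha, rfl⟩
    exact ⟨_, lact_mem hD ha _, apply_lact_comp ι f a⟩
  · rintro _ ⟨a, ha, rfl⟩
    exact ⟨_, ract_mem hD ha _, apply_ract_comp ι f a⟩

theorem IsSubcoalgebra.comap {ι : C →ₗc[k] C'} (hι : Function.Injective ι) {D : Submodule k C'}
    (hD : IsSubcoalgebra k D) : IsSubcoalgebra k (D.comap ι.toLinearMap) := by
  refine isSubcoalgebra_of_forall_mem (fun f => ?_) (fun f => ?_)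
  · obtain ⟨f', rfl⟩ := exists_dual_comp_eq hι f
    intro a ha
    change ι (lact (f' ∘ₗ ι.toLinearMap) a) ∈ D
    rw [apply_lact_comp]
    exact lact_mem hD ha _
  · obtain ⟨f', rfl⟩ := exists_dual_comp_eq hι f
    intro a ha
    change ι (ract (f' ∘ₗ ι.toLinearMap) a) ∈ D
    rw [apply_ract_comp]
    exact ract_mem hD ha _

theorem IsSimpleSubcoalgebra.map {ι : C →ₗc[k] C'} (hι : Function.Injective ι)
    {D : Submodule k C} (hD : IsSimpleSubcoalgebra k D) :
    IsSimpleSubcoalgebra k (D.map ι.toLinearMap) := by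
  have hι' : Function.Injective ι.toLinearMap := hι
  refine ⟨hD.1.map ι, ?_, fun E hE hEs => ?_⟩
  · rw [← Submodule.map_bot ι.toLinearMap]
    exact (Submodule.map_injective_of_injective hι').ne hD.2.1
  · have hEr : (E.comap ι.toLinearMap).map ι.toLinearMap = E :=
      Submodule.map_comap_eq_self (hE.trans (LinearMap.map_le_range))
    have hle : E.comap ι.toLinearMap ≤ D := by
      rw [← Submodule.comap_map_eq_of_injective hι' D]
      exact Submodule.comap_mono hE
    rcases hD.2.2 _ hle (hEs.comap hι) with h | h
    · left
      rw [← hEr, h, Submodule.map_bot]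
    · right
      rw [← hEr, h]

theorem coradical_eq_of_injective {ι : C →ₗc[k] C'} (hι : Function.Injective ι)
    (hΔ : IsGroupLikeElem k g) (hg : coradical k C' = Submodule.span k {ι g}) :
    coradical k C = Submodule.span k {g} := by
  refine le_antisymm (sSup_le fun D hD => ?_)
    (le_sSup (isSimpleSubcoalgebra_span_singleton hΔ))
  have h1 : D.map ι.toLinearMap ≤ coradical k C' := le_sSup (hD.map hι)
  rw [hg, show Submodule.span k {ι g} = (Submodule.span k {g}).map ι.toLinearMap by
    rw [Submodule.map_span, Set.image_singleton]; rfl] at h1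
  exact (Submodule.map_le_map_iff_of_injective (f := ι.toLinearMap) hι _ _).1 h1

/-- Every functional on the smaller coalgebra extends to the larger one, so the two recursions for
the filtration test the same conditions. -/
theorem mem_coradicalFiltration_iff_of_injective {ι : C →ₗc[k] C'} (hι : Function.Injective ι)
    (hΔ : IsGroupLikeElem k g) (hg : coradical k C' = Submodule.span k {ι g}) {n : ℕ} {a : C} :
    a ∈ coradicalFiltration k C n ↔ ι a ∈ coradicalFiltration k C' n := by
  have hg' := coradical_eq_of_injective hι hΔ hg
  induction n generalizing a with
  | zero =>
    rw [coradicalFiltration, coradicalFiltration, hg, hg',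
      show Submodule.span k {ι g} = (Submodule.span k {g}).map ι.toLinearMap by
        rw [Submodule.map_span, Set.image_singleton]; rfl]
    exact (hι.mem_set_image (s := (Submodule.span k {g} : Set C))).symm
  | succ n ih =>
    rw [mem_coradicalFiltration_succ hg, mem_coradicalFiltration_succ hg']
    constructor
    · intro h f hf
      rw [← apply_lact_comp]
      exact ih.1 (h _ hf)
    · intro h f hf
      obtain ⟨f', rfl⟩ := exists_dual_comp_eq hι f
      refine ih.2 ?_
      rw [apply_lact_comp]
      exact h _ hf

end SimpleSubcoalgebras

/-! ### Exhaustiveness of the coradical filtration -/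

section Exhaustive

open WithConv

variable {k : Type*} [Field k] {C : Type*} [AddCommGroup C] [Module k C] [Coalgebra k C] {g : C}

theorem convMul_apply_eq_lact (f h : WithConv (C →ₗ[k] k)) (a : C) :
    (f * h).ofConv a = h.ofConv (lact f.ofConv a) := by
  rw [lact_apply]
  change LinearMap.mul' k k (TensorProduct.map f.ofConv h.ofConv (Coalgebra.comul (R := k) a)) = _
  generalize Coalgebra.comul (R := k) a = t
  induction t with
  | zero => simp
  | tmul x y => simp
  | add x y hx hy => simp only [map_add, hx, hy]

theorem convMul_apply_eq_ract (f h : WithConv (C →ₗ[k] k)) (a : C) :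
    (f * h).ofConv a = f.ofConv (ract h.ofConv a) := by
  rw [convMul_apply_eq_lact, apply_lact]

theorem exists_coradicalFiltration_eq_top [FiniteDimensional k C]
    (hg : coradical k C = Submodule.span k {g}) (hΔ : IsGroupLikeElem k g) :
    ∃ n, coradicalFiltration k C n = ⊤ := by
  let R := WithConv (C →ₗ[k] k)
  have : FiniteDimensional k R :=
    Module.Finite.equiv (WithConv.linearEquiv k (C →ₗ[k] k)).symm
  have hart : IsArtinianRing R := IsArtinianRing.of_finite k R
  -- The kernel of evaluation at `g` in the convolution algebra dual to `C`. Its nilpotency is what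
  -- bounds the length of the filtration.
  let J : Ideal R :=
    { carrier := {f | f.ofConv g = 0}
      add_mem' := fun {x y} hx hy => by
        simp only [Set.mem_ofPred_eq] at hx hy ⊢
        rw [WithConv.ofConv_add, LinearMap.add_apply, hx, hy, add_zero]
      zero_mem' := rfl
      smul_mem' := fun c x hx => by
        simp only [Set.mem_ofPred_eq] at hx ⊢
        rw [smul_eq_mul, convMul_apply_eq_lact, lact_groupLike hΔ, map_smul, hx, smul_zero] }
  have hmemJ : ∀ f : R, f ∈ J ↔ f.ofConv g = 0 := fun f => Iff.rfl
  have hJts : J.IsTwoSided := ⟨fun {x} b hx => by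
    rw [hmemJ] at hx ⊢
    rw [convMul_apply_eq_lact, lact_groupLike hΔ, hx, zero_smul, map_zero]⟩
  have hJtop : J ≠ ⊤ := by
    rw [Ne, Ideal.eq_top_iff_one, hmemJ]
    change Coalgebra.counit (R := k) g ≠ 0
    rw [hΔ.counit_eq_one]
    exact one_ne_zero
  obtain ⟨N, hN⟩ : IsNilpotent J := by
    -- The common zeros of a proper two-sided ideal form a nonzero subcoalgebra. It contains a
    -- simple one, which can only be the line of `g`; hence the ideal vanishes at `g`.
    refine isNilpotent_of_forall_isTwoSided_le J hJtop fun I hI hItop => ?_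
    let I' : Submodule k (Module.Dual k C) :=
      (I.restrictScalars k).map (WithConv.linearEquiv k (C →ₗ[k] k)).toLinearMap
    have hI'top : I' ≠ ⊤ := by
      intro h
      apply hItop
      rw [eq_top_iff]
      intro f _
      obtain ⟨f', hf', hff'⟩ : f.ofConv ∈ I' := h ▸ Submodule.mem_top
      exact (WithConv.ofConv_injective hff') ▸ hf'
    have hmem : ∀ a, a ∈ I'.dualCoannihilator ↔ ∀ f ∈ I, f.ofConv a = 0 := by
      intro a
      rw [Submodule.mem_dualCoannihilator]
      constructor
      · intro h f hf
        exact h _ ⟨f, hf, rfl⟩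
      · rintro h _ ⟨f, hf, rfl⟩
        exact h f hf
    have hE : IsSubcoalgebra k I'.dualCoannihilator := by
      refine isSubcoalgebra_of_forall_mem (fun f a ha => ?_) (fun f a ha => ?_)
      · rw [hmem] at ha ⊢
        intro φ hφ
        rw [← convMul_apply_eq_lact (toConv f)]
        exact ha _ (I.mul_mem_left _ hφ)
      · rw [hmem] at ha ⊢
        intro φ hφ
        rw [← convMul_apply_eq_ract _ (toConv f)]
        exact ha _ (I.mul_mem_right _ hφ)
    have hE0 : I'.dualCoannihilator ≠ ⊥ := by
      intro h
      apply hI'top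
      rw [← Subspace.dualCoannihilator_dualAnnihilator_eq (W := I'), h,
        Submodule.dualAnnihilator_bot]
    obtain ⟨D, hD, hDs⟩ := exists_isSimpleSubcoalgebra_le hE hE0
    have hDg : D ≤ Submodule.span k {g} := hg ▸ le_sSup hDs
    have hgD : g ∈ D := by
      obtain ⟨x, hx, hx0⟩ := Submodule.exists_mem_ne_zero_of_ne_bot hDs.2.1
      obtain ⟨c, rfl⟩ := Submodule.mem_span_singleton.1 (hDg hx)
      have hc : c ≠ 0 := by rintro rfl; simp at hx0
      exact (Submodule.smul_mem_iff _ hc).1 hx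
    intro f hf
    exact (hmem g).1 (hD hgD) f hf
  -- The orthogonal of J^(n+1) lies in the n-th term; the exponent is n + 1 because the orthogonal
  -- of `J` itself is already the coradical.
  have key : ∀ n, ∀ a : C, (∀ f ∈ J ^ (n + 1), f.ofConv a = 0) →
      a ∈ coradicalFiltration k C n := by
    intro n
    induction n with
    | zero =>
      intro a ha
      rw [coradicalFiltration, hg]
      refine mem_span_singleton_of_forall_dual fun f hf => ha (toConv f) ?_
      rw [zero_add, Submodule.pow_one]
      exact hf
    | succ n ih =>
      intro a ha
      rw [mem_coradicalFiltration_succ hg]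
      intro f hf
      refine ih _ fun φ hφ => ?_
      rw [← convMul_apply_eq_lact (toConv f)]
      refine ha _ ?_
      rw [Ideal.IsTwoSided.pow_succ]
      exact Ideal.mul_mem_mul ((hmemJ _).2 hf) hφ
  refine ⟨N, eq_top_iff.2 fun a _ => key N a fun f hf => ?_⟩
  have hf' := Ideal.pow_le_pow_right N.le_succ hf
  rw [hN] at hf'
  rw [(Submodule.mem_bot R).1 hf']
  rfl

theorem exists_mem_coradicalFiltration (hg : coradical k C = Submodule.span k {g})
    (hΔ : IsGroupLikeElem k g) (a : C) : ∃ n, a ∈ coradicalFiltration k C n := by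
  obtain ⟨D₀, hD₀, hfin, haD⟩ := exists_finiteDimensional_subcoalgebra (k := k) a
  -- Adjoining `g` ensures that the finite-dimensional subcoalgebra contains the group-like element
  -- that spans its coradical.
  have hD := hD₀.sup (isSubcoalgebra_span_singleton hΔ.comul_eq_tmul_self)
  generalize hDeq : D₀ ⊔ Submodule.span k {g} = D at hD
  have hgD : g ∈ D := hDeq ▸ Submodule.mem_sup_right (Submodule.mem_span_singleton_self g)
  have haD : a ∈ D := hDeq ▸ Submodule.mem_sup_left haD
  have : FiniteDimensional k D := by rw [← hDeq]; infer_instance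
  let _ := hD.coalgebra
  let ι : D →ₗc[k] C :=
    { D.subtype with
      counit_comp := rfl
      map_comp_comul := hD.mapIncl_comp_comul }
  have hι : Function.Injective ι := D.injective_subtype
  have hΔ' : IsGroupLikeElem k (⟨g, hgD⟩ : D) := by
    refine ⟨hΔ.counit_eq_one, mapIncl_injective D D ?_⟩
    exact (LinearMap.congr_fun hD.mapIncl_comp_comul ⟨g, hgD⟩).trans hΔ.comul_eq_tmul_self
  obtain ⟨n, hn⟩ := exists_coradicalFiltration_eq_top
    (coradical_eq_of_injective (ι := ι) hι hΔ' hg) hΔ'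
  exact ⟨n, (mem_coradicalFiltration_iff_of_injective (ι := ι) hι hΔ' hg (a := ⟨a, haD⟩)).1
    (hn ▸ Submodule.mem_top)⟩

end Exhaustive

/-! ### The coradical filtration of a connected bialgebra is multiplicative and almost commutative
-/

section BialgebraFiltration

variable {k : Type*} [Field k] {R : Type*} [Ring R]

theorem mul_mem_range_mapIncl [Algebra k R] {D D' D'' E E' E'' : Submodule k R}
    (hD : ∀ x ∈ D, ∀ y ∈ D', x * y ∈ D'') (hE : ∀ x ∈ E, ∀ y ∈ E', x * y ∈ E'') {s t : R ⊗[k] R}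
    (hs : s ∈ LinearMap.range (TensorProduct.mapIncl D E))
    (ht : t ∈ LinearMap.range (TensorProduct.mapIncl D' E')) :
    s * t ∈ LinearMap.range (TensorProduct.mapIncl D'' E'') := by
  have h1 : LinearMap.range (TensorProduct.mapIncl D E) ≤
      (LinearMap.range (TensorProduct.mapIncl D'' E'')).comap (LinearMap.mulRight k t) := by
    refine range_mapIncl_induction fun x hx y hy => ?_
    have h2 : LinearMap.range (TensorProduct.mapIncl D' E') ≤
        (LinearMap.range (TensorProduct.mapIncl D'' E'')).comap
          (LinearMap.mulLeft k (x ⊗ₜ[k] y)) := by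
      refine range_mapIncl_induction fun x' hx' y' hy' => ?_
      simp only [Submodule.mem_comap, LinearMap.mulLeft_apply, Algebra.TensorProduct.tmul_mul_tmul]
      exact tmul_mem_range_mapIncl (hD _ hx _ hx') (hE _ hy _ hy')
    exact h2 ht
  exact h1 hs

theorem contractFst_mul_one_tmul [Algebra k R] (f : R →ₗ[k] k) (t : R ⊗[k] R) (b : R) :
    contractFst f (t * 1 ⊗ₜ b) = contractFst f t * b := by
  induction t with
  | zero => simp
  | tmul x y => simp
  | add x y hx hy => rw [add_mul, map_add, map_add, hx, hy, add_mul]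

theorem contractFst_one_tmul_mul [Algebra k R] (f : R →ₗ[k] k) (t : R ⊗[k] R) (b : R) :
    contractFst f (1 ⊗ₜ b * t) = b * contractFst f t := by
  induction t with
  | zero => simp
  | tmul x y => simp
  | add x y hx hy => rw [mul_add, map_add, map_add, hx, hy, mul_add]

/-- A filtration of an algebra whose associated graded algebra is commutative. -/
structure IsAlmostCommutative [Algebra k R] (F : ℤ → Submodule k R) : Prop where
  mono : Monotone F
  eq_bot_of_neg : ∀ n < 0, F n = ⊥
  one_mem : 1 ∈ F 0
  mul_mem : ∀ {i j : ℤ} {a b : R}, a ∈ F i → b ∈ F j → a * b ∈ F (i + j)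
  comm_mem : ∀ {i j : ℤ} {a b : R}, a ∈ F i → b ∈ F j → a * b - b * a ∈ F (i + j - 1)

variable [Bialgebra k R]

/-- The difference `Δ(a) - 1 ⊗ a`. -/
noncomputable def comulSub : R →ₗ[k] R ⊗[k] R :=
  Coalgebra.comul - TensorProduct.mk k R R 1

theorem comul_eq_add_comulSub (a : R) :
    Coalgebra.comul (R := k) a = 1 ⊗ₜ[k] a + comulSub (k := k) a := by
  simp [comulSub]

theorem contractFst_comulSub (f : R →ₗ[k] k) (a : R) :
    contractFst f (comulSub (k := k) a) = lact f a - f 1 • a := by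
  simp [comulSub, lact_apply]

/-- Subtracting 1 ⊗ a replaces f by f - f(1)ε, which vanishes at 1 and therefore lowers the degree
by one. No condition on f remains. -/
theorem contractFst_comulSub_mem (hR : coradical k R = Submodule.span k {(1 : R)}) {n : ℤ} {a : R}
    (ha : a ∈ intFiltration k R n) (f : R →ₗ[k] k) :
    contractFst f (comulSub (k := k) a) ∈ intFiltration k R (n - 1) := by
  rw [contractFst_comulSub]
  have h1 : lact f a - f 1 • a = lact (f + (-f 1) • Coalgebra.counit) a := by
    rw [lact_add, lact_smul, lact_counit, neg_smul, sub_eq_add_neg]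
  rw [h1]
  refine lact_mem_intFiltration_sub hR IsGroupLikeElem.one (fun x hx => ?_) ha
  rw [show (1 : ℤ) - 1 = 0 by norm_num, intFiltration_zero hR] at hx
  exact eq_zero_of_mem_span_singleton hx (by simp)

theorem comulSub_mem (hR : coradical k R = Submodule.span k {(1 : R)}) {n : ℤ} {a : R}
    (ha : a ∈ intFiltration k R n) : comulSub (k := k) a ∈
      LinearMap.range (TensorProduct.mapIncl (⊤ : Submodule k R) (intFiltration k R (n - 1))) :=
  mem_range_mapIncl_top_iff.2 (contractFst_comulSub_mem hR ha)

theorem mem_intFiltration_of_comulSub_mem (hR : coradical k R = Submodule.span k {(1 : R)}) {n : ℤ}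
    (hn : 0 < n) {a : R} (ha : comulSub (k := k) a ∈
      LinearMap.range (TensorProduct.mapIncl (⊤ : Submodule k R) (intFiltration k R (n - 1)))) :
    a ∈ intFiltration k R n := by
  rw [mem_intFiltration hR hn]
  intro f hf
  have := contractFst_mem ha f
  rwa [contractFst_comulSub, hf, zero_smul, sub_zero] at this

/-- The comultiplication is compatible with the coradical filtration. -/
theorem comulSub_mem_iSup (hR : coradical k R = Submodule.span k {(1 : R)}) {n : ℤ} {a : R}
    (ha : a ∈ intFiltration k R n) : comulSub (k := k) a ∈
      ⨆ p : ℕ, LinearMap.range (TensorProduct.mapIncl (intFiltration k R (p + 1))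
        (intFiltration k R (n - p - 1))) := by
  have hmono := intFiltration_mono hR IsGroupLikeElem.one
  -- The tensor lemma needs a filtration starting at zero. At index 0 all functionals are then
  -- allowed, which is harmless because `comulSub` drops a degree for every functional.
  let F : ℕ → Submodule k R := fun p => if p = 0 then ⊥ else intFiltration k R p
  have hF : Monotone F := by
    intro p q hpq
    by_cases hp : p = 0
    · simp [F, hp]
    · simp only [F, hp, show q ≠ 0 by omega, if_false]
      exact hmono (by exact_mod_cast hpq)
  have key := mem_iSup_range_mapIncl (F := F) (G := fun p => intFiltration k R (n - p - 1))
    (m := n.toNat + 1) (t := comulSub (k := k) a) hF (by simp [F]) ?_ ?_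
  · exact key
  · refine mem_range_mapIncl_top_right_iff.2 fun g => ?_
    have h1 : contractSnd g (comulSub (k := k) a) = ract g a - g a • 1 := by
      simp [comulSub, ract_apply]
    rw [h1]
    simp only [F, Nat.succ_ne_zero, if_false]
    refine Submodule.sub_mem _ (hmono (by omega)
      (ract_mem_intFiltration hR IsGroupLikeElem.one ha g)) (Submodule.smul_mem _ _ ?_)
    refine hmono (show (0 : ℤ) ≤ _ by omega) ?_
    rw [intFiltration_zero hR]
    exact Submodule.mem_span_singleton_self _
  · intro p f hf
    by_cases hp : p = 0
    · subst hp
      simpa using contractFst_comulSub_mem hR ha f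
    · simp only [F, hp, if_false] at hf
      have hf1 : f 1 = 0 := hf 1 (hmono (show (0 : ℤ) ≤ _ by omega) (by
        rw [intFiltration_zero hR]; exact Submodule.mem_span_singleton_self _))
      rw [contractFst_comulSub, hf1, zero_smul, sub_zero]
      have := lact_mem_intFiltration_sub hR IsGroupLikeElem.one (p := p + 1) (f := f)
        (by simpa using hf) ha
      rwa [← sub_sub] at this

theorem comulSub_mul (a b : R) : comulSub (k := k) (a * b) =
    comulSub (k := k) a * 1 ⊗ₜ b + 1 ⊗ₜ a * comulSub (k := k) b +
      comulSub (k := k) a * comulSub (k := k) b := by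
  have h := Bialgebra.comul_mul (R := k) a b
  rw [comul_eq_add_comulSub, comul_eq_add_comulSub a, comul_eq_add_comulSub b, add_mul, mul_add,
    mul_add, Algebra.TensorProduct.tmul_mul_tmul, mul_one, add_assoc] at h
  rw [add_left_cancel h]
  abel

/-- Induction on i + j. In the expansion of `comulSub (a * b)` each term has a right factor of total
degree at most i + j - 1 by induction, and this characterises degree i + j. -/
theorem intFiltration_mul_mem (hR : coradical k R = Submodule.span k {(1 : R)}) {i j : ℤ}
    {a b : R} (ha : a ∈ intFiltration k R i) (hb : b ∈ intFiltration k R j) :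
    a * b ∈ intFiltration k R (i + j) := by
  have hmono := intFiltration_mono hR IsGroupLikeElem.one
  obtain ⟨n, hn⟩ : ∃ n : ℕ, (i + j).toNat = n := ⟨_, rfl⟩
  induction n using Nat.strong_induction_on generalizing i j a b with
  | _ n ih =>
    rcases lt_trichotomy i 0 with hi | rfl | hi
    · rw [intFiltration_of_neg hi, Submodule.mem_bot] at ha
      simp [ha]
    · rw [intFiltration_zero hR] at ha
      obtain ⟨c, rfl⟩ := Submodule.mem_span_singleton.1 ha
      simpa using Submodule.smul_mem _ c hb
    rcases lt_trichotomy j 0 with hj | rfl | hj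
    · rw [intFiltration_of_neg hj, Submodule.mem_bot] at hb
      simp [hb]
    · rw [intFiltration_zero hR] at hb
      obtain ⟨c, rfl⟩ := Submodule.mem_span_singleton.1 hb
      simpa using Submodule.smul_mem _ c ha
    refine mem_intFiltration_of_comulSub_mem hR (by omega) ?_
    rw [comulSub_mul]
    have h1 := comulSub_mem hR ha
    have h2 := comulSub_mem hR hb
    have top : ∀ x ∈ (⊤ : Submodule k R), ∀ y ∈ (⊤ : Submodule k R),
        x * y ∈ (⊤ : Submodule k R) := fun _ _ _ _ => Submodule.mem_top
    refine Submodule.add_mem _ (Submodule.add_mem _ ?_ ?_) ?_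
    · refine mul_mem_range_mapIncl top (fun x hx y hy => ?_) h1
        (tmul_mem_range_mapIncl Submodule.mem_top hb)
      exact hmono (by omega) (ih _ (by omega) hx hy rfl)
    · refine mul_mem_range_mapIncl top (fun x hx y hy => ?_)
        (tmul_mem_range_mapIncl Submodule.mem_top ha) h2
      exact hmono (by omega) (ih _ (by omega) hx hy rfl)
    · refine mul_mem_range_mapIncl top (fun x hx y hy => ?_) h1 h2
      exact hmono (by omega) (ih _ (by omega) hx hy rfl)

/-- With δ = `comulSub`, δ[a,b] = [δa, 1 ⊗ b] + [1 ⊗ a, δb] + [δa, δb]. The first two terms are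
handled by induction; in the last each of the two products already has right factors of degree i + j
- 2. -/
theorem intFiltration_comm_mem (hR : coradical k R = Submodule.span k {(1 : R)}) {i j : ℤ}
    {a b : R} (ha : a ∈ intFiltration k R i) (hb : b ∈ intFiltration k R j) :
    a * b - b * a ∈ intFiltration k R (i + j - 1) := by
  have hmono := intFiltration_mono hR IsGroupLikeElem.one
  obtain ⟨n, hn⟩ : ∃ n : ℕ, (i + j).toNat = n := ⟨_, rfl⟩
  induction n using Nat.strong_induction_on generalizing i j a b with
  | _ n ih =>
    rcases lt_trichotomy i 0 with hi | rfl | hi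
    · rw [intFiltration_of_neg hi, Submodule.mem_bot] at ha
      simp [ha]
    · rw [intFiltration_zero hR] at ha
      obtain ⟨c, rfl⟩ := Submodule.mem_span_singleton.1 ha
      simp
    rcases lt_trichotomy j 0 with hj | rfl | hj
    · rw [intFiltration_of_neg hj, Submodule.mem_bot] at hb
      simp [hb]
    · rw [intFiltration_zero hR] at hb
      obtain ⟨c, rfl⟩ := Submodule.mem_span_singleton.1 hb
      simp
    refine mem_intFiltration_of_comulSub_mem hR (by omega) ?_
    have h1 := comulSub_mem hR ha
    have h2 := comulSub_mem hR hb
    have hcomm : ∀ {i j : ℤ} {a b : R}, b ∈ intFiltration k R j → (i + j).toNat < n →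
        LinearMap.range (TensorProduct.mapIncl (⊤ : Submodule k R) (intFiltration k R i)) ≤
          (LinearMap.range (TensorProduct.mapIncl (⊤ : Submodule k R)
            (intFiltration k R (i + j - 1)))).comap
            (LinearMap.mulRight k (1 ⊗ₜ[k] b) - LinearMap.mulLeft k (1 ⊗ₜ[k] b)) := by
      intro i j a b hb hij
      refine range_mapIncl_induction fun x hx y hy => ?_
      simp only [Submodule.mem_comap, LinearMap.sub_apply, LinearMap.mulRight_apply,
        LinearMap.mulLeft_apply, Algebra.TensorProduct.tmul_mul_tmul, mul_one, one_mul,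
        ← TensorProduct.tmul_sub]
      exact tmul_mem_range_mapIncl hx (ih _ hij hy hb rfl)
    have top : ∀ x ∈ (⊤ : Submodule k R), ∀ y ∈ (⊤ : Submodule k R),
        x * y ∈ (⊤ : Submodule k R) := fun _ _ _ _ => Submodule.mem_top
    have e1 := hcomm (a := a) hb (by omega) h1
    have e2 := hcomm (a := a) ha (by omega) h2
    have e3 := mul_mem_range_mapIncl top (E'' := intFiltration k R (i + j - 1 - 1))
      (fun x hx y hy => hmono (by omega) (intFiltration_mul_mem hR hx hy)) h1 h2
    have e4 := mul_mem_range_mapIncl top (E'' := intFiltration k R (i + j - 1 - 1))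
      (fun x hx y hy => hmono (by omega) (intFiltration_mul_mem hR hx hy)) h2 h1
    simp only [Submodule.mem_comap, LinearMap.sub_apply, LinearMap.mulRight_apply,
        LinearMap.mulLeft_apply] at e1 e2
    rw [show i - 1 + j - 1 = i + j - 1 - 1 by ring] at e1
    rw [show j - 1 + i - 1 = i + j - 1 - 1 by ring] at e2
    rw [map_sub, comulSub_mul, comulSub_mul]
    convert Submodule.add_mem _ (Submodule.sub_mem _ e1 e2) (Submodule.sub_mem _ e3 e4) using 1
    abel

theorem isAlmostCommutative_intFiltration (hR : coradical k R = Submodule.span k {(1 : R)}) :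
    IsAlmostCommutative (intFiltration k R) where
  mono := intFiltration_mono hR IsGroupLikeElem.one
  eq_bot_of_neg _ := intFiltration_of_neg
  one_mem := by
    rw [intFiltration_zero hR]
    exact Submodule.mem_span_singleton_self _
  mul_mem := intFiltration_mul_mem hR
  comm_mem := intFiltration_comm_mem hR

/-- A functional vanishing in degrees `< d` and on decomposable elements of degree `d` induces a
derivation of the associated graded algebra. -/
theorem lact_mul_sub_mem (hR : coradical k R = Submodule.span k {(1 : R)}) {d : ℤ} (hd : 0 < d)
    {f : R →ₗ[k] k} (hf : ∀ x ∈ intFiltration k R (d - 1), f x = 0)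
    (hf' : ∀ p q : ℤ, 0 < p → 0 < q → p + q = d → ∀ x ∈ intFiltration k R p,
      ∀ y ∈ intFiltration k R q, f (x * y) = 0) {i j : ℤ}
    {a b : R} (ha : a ∈ intFiltration k R i) (hb : b ∈ intFiltration k R j) :
    lact f (a * b) - (lact f a * b + a * lact f b) ∈ intFiltration k R (i + j - d - 1) := by
  have hF := isAlmostCommutative_intFiltration hR
  have hf1 : f 1 = 0 := hf 1 (hF.mono (by omega) hF.one_mem)
  have hlact : ∀ c : R, lact f c = contractFst f (comulSub (k := k) c) := by
    intro c
    rw [contractFst_comulSub, hf1, zero_smul, sub_zero]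
  rw [hlact, comulSub_mul, map_add, map_add, contractFst_mul_one_tmul, contractFst_one_tmul_mul,
    ← hlact, ← hlact, add_sub_cancel_left]
  -- Only the cross term δa · δb obstructs the Leibniz rule. If its left factor has degree below d,
  -- or is decomposable of degree exactly d, then `f` kills it; if the degree exceeds d, the right
  -- factor is small enough.
  have h1 : ∀ p q : ℕ, ∀ x ∈ intFiltration k R (p + 1), ∀ y ∈ intFiltration k R (i - p - 1),
      ∀ x' ∈ intFiltration k R (q + 1), ∀ y' ∈ intFiltration k R (j - q - 1),
      f (x * x') • (y * y') ∈ intFiltration k R (i + j - d - 1) := by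
    intro p q x hx y hy x' hx' y' hy'
    rcases lt_trichotomy ((p + 1 : ℤ) + (q + 1)) d with h | h | h
    · rw [hf _ (hF.mono (by omega) (hF.mul_mem hx hx')), zero_smul]
      exact Submodule.zero_mem _
    · rw [hf' _ _ (by omega) (by omega) h x hx x' hx', zero_smul]
      exact Submodule.zero_mem _
    · exact Submodule.smul_mem _ _ (hF.mono (by omega) (hF.mul_mem hy hy'))
  have h2 : (⨆ p : ℕ, LinearMap.range (TensorProduct.mapIncl (intFiltration k R (p + 1))
        (intFiltration k R (i - p - 1)))) ≤ (intFiltration k R (i + j - d - 1)).comap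
        (contractFst f ∘ₗ LinearMap.mulRight k (comulSub (k := k) b)) := by
    refine iSup_le fun p => range_mapIncl_induction fun x hx y hy => ?_
    have h3 : (⨆ q : ℕ, LinearMap.range (TensorProduct.mapIncl (intFiltration k R (q + 1))
        (intFiltration k R (j - q - 1)))) ≤ (intFiltration k R (i + j - d - 1)).comap
        (contractFst f ∘ₗ LinearMap.mulLeft k (x ⊗ₜ[k] y)) := by
      refine iSup_le fun q => range_mapIncl_induction fun x' hx' y' hy' => ?_
      simpa using h1 p q x hx y hy x' hx' y' hy'
    exact h3 (comulSub_mem_iSup hR hb)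
  exact h2 (comulSub_mem_iSup hR ha)

end BialgebraFiltration

/-! ### Monomials and derivations modulo lower degree -/

section OrderedMonomials

variable {k : Type*} [Field k] {R : Type*} [Ring R] [Algebra k R] {F : ℤ → Submodule k R}
  {Γ : Type*}

/-- The weight of a multiset of generators. -/
def weight (d : Γ → ℕ) (s : Multiset Γ) : ℕ := (s.map d).sum

@[simp]
theorem weight_zero (d : Γ → ℕ) : weight d 0 = 0 := by simp [weight]

@[simp]
theorem weight_cons (d : Γ → ℕ) (γ : Γ) (s : Multiset Γ) :
    weight d (γ ::ₘ s) = d γ + weight d s := by simp [weight]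

theorem weight_add (d : Γ → ℕ) (s t : Multiset Γ) :
    weight d (s + t) = weight d s + weight d t := by simp [weight]

/-- The product of the generators in a multiset, in nondecreasing order. -/
def sortedMonomial [LinearOrder Γ] (x : Γ → R) (s : Multiset Γ) : R :=
  ((s.sort (· ≤ ·)).map x).prod

variable {x : Γ → R} {d : Γ → ℕ}

theorem IsAlmostCommutative.list_prod_mem (hF : IsAlmostCommutative F) (hx : ∀ γ, x γ ∈ F (d γ))
    (l : List Γ) : (l.map x).prod ∈ F (weight d l) := by
  induction l with
  | nil => simpa using hF.one_mem
  | cons γ l ih =>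
    rw [List.map_cons, List.prod_cons, ← Multiset.cons_coe, weight_cons]
    push_cast
    exact hF.mul_mem (hx γ) ih

/-- A permutation is a composite of adjacent swaps, and each swap costs a commutator, of degree one
less. -/
theorem IsAlmostCommutative.list_prod_sub_mem (hF : IsAlmostCommutative F)
    (hx : ∀ γ, x γ ∈ F (d γ)) {l l' : List Γ} (h : l.Perm l') :
    (l.map x).prod - (l'.map x).prod ∈ F (weight d l - 1) := by
  induction h with
  | nil => simp
  | cons γ _ ih =>
    simp only [List.map_cons, List.prod_cons, ← mul_sub, ← Multiset.cons_coe, weight_cons]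
    have := hF.mul_mem (hx γ) ih
    push_cast
    rwa [← add_sub_assoc] at this
  | swap γ γ' l =>
    simp only [List.map_cons, List.prod_cons, ← Multiset.cons_coe, weight_cons]
    have := hF.mul_mem (hF.comm_mem (hx γ') (hx γ)) (hF.list_prod_mem hx l)
    push_cast
    rw [← mul_assoc, ← mul_assoc, ← sub_mul]
    convert this using 2
    ring
  | trans h₁ _ ih₁ ih₂ =>
    rw [← Multiset.coe_eq_coe.2 h₁] at ih₂
    simpa using Submodule.add_mem _ ih₁ ih₂

theorem IsAlmostCommutative.sortedMonomial_mem [LinearOrder Γ] (hF : IsAlmostCommutative F)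
    (hx : ∀ γ, x γ ∈ F (d γ)) (s : Multiset Γ) : sortedMonomial x s ∈ F (weight d s) := by
  have := hF.list_prod_mem hx (s.sort (· ≤ ·))
  rwa [Multiset.sort_eq] at this

theorem IsAlmostCommutative.list_prod_sub_sortedMonomial_mem [LinearOrder Γ]
    (hF : IsAlmostCommutative F) (hx : ∀ γ, x γ ∈ F (d γ)) (l : List Γ) :
    (l.map x).prod - sortedMonomial x l ∈ F (weight d l - 1) :=
  hF.list_prod_sub_mem hx (by rw [← Multiset.coe_eq_coe, Multiset.sort_eq])

theorem IsAlmostCommutative.sortedMonomial_mul_sub_mem [LinearOrder Γ]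
    (hF : IsAlmostCommutative F) (hx : ∀ γ, x γ ∈ F (d γ)) (s t : Multiset Γ) :
    sortedMonomial x s * sortedMonomial x t - sortedMonomial x (s + t) ∈
      F (weight d (s + t) - 1) := by
  have := hF.list_prod_sub_sortedMonomial_mem hx (s.sort (· ≤ ·) ++ t.sort (· ≤ ·))
  rwa [List.map_append, List.prod_append, ← Multiset.coe_add, Multiset.sort_eq,
    Multiset.sort_eq] at this

/-- An operator lowering the degree by `e` and satisfying the Leibniz rule up to terms of lower
degree. -/
structure IsFilteredDerivation (F : ℤ → Submodule k R) (e : ℕ) (D : R →ₗ[k] R) : Prop where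
  map_mem : ∀ {n : ℤ} {a : R}, a ∈ F n → D a ∈ F (n - e)
  leibniz : ∀ {i j : ℤ} {a b : R}, a ∈ F i → b ∈ F j →
    D (a * b) - (D a * b + a * D b) ∈ F (i + j - e - 1)

/-- Modulo lower degree, `D` sends x_β to 1 and the other factors to 0, so the Leibniz rule makes it
act as ∂/∂x_β. -/
theorem IsFilteredDerivation.list_prod [DecidableEq Γ] (hF : IsAlmostCommutative F)
    (hx : ∀ γ, x γ ∈ F (d γ)) {β : Γ} {D : R →ₗ[k] R} (hD : IsFilteredDerivation F (d β) D)
    {l : List Γ} (hl : ∀ γ ∈ l, D (x γ) - (if γ = β then 1 else 0) ∈ F (d γ - d β - 1)) :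
    D (l.map x).prod - l.count β • ((l.erase β).map x).prod ∈ F (weight d l - d β - 1) := by
  induction l with
  | nil =>
    have := hD.leibniz hF.one_mem hF.one_mem
    simpa using this
  | cons γ l ih =>
    have hγ := hl γ List.mem_cons_self
    have ih := ih fun γ' h => hl γ' (List.mem_cons_of_mem _ h)
    have hp := hF.list_prod_mem hx l
    rw [List.map_cons, List.prod_cons, ← Multiset.cons_coe, weight_cons]
    have e1 := hD.leibniz (hx γ) hp
    have e2 := hF.mul_mem hγ hp
    have e3 := hF.mul_mem (hx γ) ih
    set p := (l.map x).prod with hpdef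
    have e1' : D (x γ * p) - (D (x γ) * p + x γ * D p) ∈
        F ((d γ + weight d l : ℕ) - d β - 1) := by
      push_cast; exact e1
    have e2' : (D (x γ) - if γ = β then 1 else 0) * p ∈ F ((d γ + weight d l : ℕ) - d β - 1) := by
      convert e2 using 2; push_cast; ring
    have e3' : x γ * (D p - l.count β • ((l.erase β).map x).prod) ∈
        F ((d γ + weight d l : ℕ) - d β - 1) := by
      convert e3 using 2; push_cast; ring
    by_cases hγβ : γ = β
    · subst hγβ
      rw [List.count_cons_self, List.erase_cons_head]
      -- The Leibniz rule leaves the new factor in front of a product with one later occurrence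
      -- removed; reordering identifies this with the product `p` up to lower degree.
      have e4 : l.count γ • (x γ * ((l.erase γ).map x).prod - p) ∈
          F ((d γ + weight d l : ℕ) - d γ - 1) := by
        by_cases hmem : γ ∈ l
        · refine Submodule.smul_of_tower_mem _ _ ?_
          have := hF.list_prod_sub_mem hx (List.perm_cons_erase hmem)
          rw [List.map_cons, List.prod_cons] at this
          rw [← Submodule.neg_mem_iff, neg_sub, show ((d γ + weight d l : ℕ) : ℤ) - d γ - 1 =
            weight d l - 1 by push_cast; ring]
          exact this
        · rw [List.count_eq_zero_of_not_mem hmem, zero_smul]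
          exact Submodule.zero_mem _
      rw [if_pos rfl] at e2'
      convert Submodule.add_mem _ (Submodule.add_mem _ e1' e2') (Submodule.add_mem _ e3' e4) using 1
      rw [mul_sub, sub_mul, one_mul, mul_smul_comm, smul_sub, add_smul, one_smul]
      abel
    · rw [List.count_cons_of_ne hγβ, List.erase_cons_tail (by simpa using hγβ), List.map_cons,
        List.prod_cons]
      rw [if_neg hγβ, sub_zero] at e2'
      convert Submodule.add_mem _ (Submodule.add_mem _ e1' e2') e3' using 1
      rw [mul_sub, mul_smul_comm]
      abel

theorem IsFilteredDerivation.sortedMonomial [LinearOrder Γ] (hF : IsAlmostCommutative F)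
    (hx : ∀ γ, x γ ∈ F (d γ)) {β : Γ} {D : R →ₗ[k] R} (hD : IsFilteredDerivation F (d β) D)
    {s : Multiset Γ} (hs : ∀ γ ∈ s, D (x γ) - (if γ = β then 1 else 0) ∈ F (d γ - d β - 1)) :
    D (sortedMonomial x s) - s.count β • sortedMonomial x (s.erase β) ∈
      F (weight d s - d β - 1) := by
  have h1 := IsFilteredDerivation.list_prod hF hx hD (l := s.sort (· ≤ ·))
    (fun γ hγ => hs γ ((Multiset.mem_sort _).1 hγ))
  rw [← Multiset.coe_count, Multiset.sort_eq] at h1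
  by_cases hβ : β ∈ s
  · have h2 := hF.list_prod_sub_sortedMonomial_mem hx ((s.sort (· ≤ ·)).erase β)
    rw [← Multiset.coe_erase, Multiset.sort_eq] at h2
    have h3 : weight d s = d β + weight d (s.erase β) := by
      rw [← weight_cons, Multiset.cons_erase hβ]
    convert Submodule.add_mem _ h1 (Submodule.smul_of_tower_mem _ (s.count β) (hF.mono
      (show (weight d (s.erase β) : ℤ) - 1 ≤ weight d s - d β - 1 by omega) h2)) using 1
    rw [_root_.sortedMonomial, smul_sub]
    abel
  · rw [Multiset.count_eq_zero_of_notMem hβ, zero_smul] at h1 ⊢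
    exact h1

end OrderedMonomials

/-! ### Independence and spanning of the ordered monomials -/

section PolynomialSystems

variable {k : Type*} [Field k] {R : Type*} [Ring R] [Algebra k R]

/-- Elements `x γ` of degree `d γ`, whose symbols are algebraically independent over the graded
algebra of `B` as witnessed by the operators `D γ`, and generate the graded algebra of `R` over
it. -/
structure IsPolynomialSystem (F : ℤ → Submodule k R) (B : Subalgebra k R) {Γ : Type*}
    (x : Γ → R) (d : Γ → ℕ) (D : Γ → R →ₗ[k] R) : Prop where
  almostComm : IsAlmostCommutative F
  zero_le : F 0 ≤ Subalgebra.toSubmodule B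
  pos : ∀ γ, 0 < d γ
  mem : ∀ γ, x γ ∈ F (d γ)
  deriv : ∀ γ, IsFilteredDerivation F (d γ) (D γ)
  apply_coeff : ∀ γ, ∀ b ∈ B, D γ b = 0
  apply_self : ∀ γ, D γ (x γ) - 1 ∈ F (-1)
  apply_of_ne : ∀ γ β, β ≠ γ → d β ≤ d γ → D γ (x β) ∈ F (d β - d γ - 1)
  le_sup : ∀ n : ℕ, 0 < n → F n ≤ F (n - 1) ⊔ (Subalgebra.toSubmodule B ⊓ F n) ⊔
    Submodule.span k (x '' {γ | d γ = n}) ⊔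
      ⨆ (p : ℕ) (q : ℕ) (_ : 0 < p) (_ : 0 < q) (_ : p + q = n), F p * F q

namespace IsPolynomialSystem

variable {F : ℤ → Submodule k R} {B : Subalgebra k R} {Γ : Type*} [LinearOrder Γ]
  {x : Γ → R} {d : Γ → ℕ} {D : Γ → R →ₗ[k] R}

theorem apply_mul_sortedMonomial (h : IsPolynomialSystem F B x d D) {n : ℤ} {β : Γ}
    {s : Multiset Γ} (hs : ∀ γ ∈ s, d γ ≤ d β) {b : R} (hb : b ∈ B)
    (hbn : b ∈ F (n - weight d s)) :
    D β (b * sortedMonomial x s) - s.count β • b * sortedMonomial x (s.erase β) ∈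
      F (n - d β - 1) := by
  have hF := h.almostComm
  have h1 := (h.deriv β).leibniz hbn (hF.sortedMonomial_mem h.mem s)
  rw [h.apply_coeff β b hb, zero_mul, zero_add, sub_add_cancel] at h1
  have h2 := (h.deriv β).sortedMonomial hF h.mem (s := s) (fun γ hγ => by
    split_ifs with hγβ
    · subst hγβ
      simpa using h.apply_self γ
    · rw [sub_zero]
      exact h.apply_of_ne _ _ hγβ (hs γ hγ))
  have h3 := hF.mul_mem hbn h2
  rw [show n - weight d s + (weight d s - d β - 1) = n - d β - 1 by ring] at h3
  convert Submodule.add_mem _ h1 h3 using 1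
  rw [mul_sub, smul_mul_assoc, mul_smul_comm]
  abel

/-- The symbols of the ordered monomials are linearly independent over the graded algebra
of `B`. -/
theorem coeff_mem [CharZero k] (h : IsPolynomialSystem F B x d D) {n : ℤ}
    {S : Finset (Multiset Γ)} {b : Multiset Γ → R} (hb : ∀ s ∈ S, b s ∈ B)
    (hbn : ∀ s ∈ S, b s ∈ F (n - weight d s))
    (hsum : ∑ s ∈ S, b s * sortedMonomial x s ∈ F (n - 1)) :
    ∀ s ∈ S, b s ∈ F (n - 1 - weight d s) := by
  have hF := h.almostComm
  obtain ⟨N, hN⟩ : ∃ N : ℕ, n < N := ⟨n.toNat + 1, by omega⟩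
  induction N generalizing n S b with
  | zero =>
    intro s hs
    have := hbn s hs
    rw [hF.eq_bot_of_neg _ (by push_cast at hN; omega), Submodule.mem_bot] at this
    rw [this]
    exact Submodule.zero_mem _
  | succ N ih =>
    classical
    by_contra hcon
    push Not at hcon
    -- Only the offending terms are kept; the others contribute in degree n - 1 and do not affect
    -- the hypothesis.
    set T := S.filter fun s => b s ∉ F (n - 1 - weight d s) with hT
    have hTS : T ⊆ S := Finset.filter_subset _ _
    have hTsum : ∑ s ∈ T, b s * sortedMonomial x s ∈ F (n - 1) := by
      rw [← Finset.sum_filter_add_sum_filter_not S fun s => b s ∉ F (n - 1 - weight d s)] at hsum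
      refine (Submodule.add_mem_iff_left _ (Submodule.sum_mem _ fun s hs => ?_)).1 hsum
      rw [Finset.mem_filter, not_not] at hs
      have := hF.mul_mem hs.2 (hF.sortedMonomial_mem h.mem s)
      rwa [sub_add_cancel] at this
    obtain ⟨s₀, hs₀, hs₀'⟩ := hcon
    have hs₀T : s₀ ∈ T := Finset.mem_filter.2 ⟨hs₀, hs₀'⟩
    let V : Finset Γ := T.biUnion Multiset.toFinset
    have hmemV : ∀ s ∈ T, ∀ γ ∈ s, γ ∈ V := fun s hs γ hγ =>
      Finset.mem_biUnion.2 ⟨s, hs, Multiset.mem_toFinset.2 hγ⟩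
    rcases V.eq_empty_or_nonempty with hV | hV
    · have hz : ∀ s ∈ T, s = 0 := fun s hs => Multiset.eq_zero_of_forall_notMem fun γ hγ => by
        simpa [hV] using hmemV s hs γ hγ
      have hT0 : T = {0} := by
        refine Finset.eq_singleton_iff_unique_mem.2 ⟨hz s₀ hs₀T ▸ hs₀T, hz⟩
      rw [hT0, Finset.sum_singleton] at hTsum
      rw [hz s₀ hs₀T] at hs₀'
      apply hs₀'
      simpa [sortedMonomial] using hTsum
    -- The degree of `β` must be maximal among the generators that occur: `D β` is controlled only
    -- on generators of degree at most `d β`.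
    · obtain ⟨β, hβV, hβ⟩ := V.exists_max_image d hV
      obtain ⟨s₁, hs₁, hs₁β⟩ := Finset.mem_biUnion.1 hβV
      rw [Multiset.mem_toFinset] at hs₁β
      have hD1 : ∑ s ∈ T, s.count β • b s * sortedMonomial x (s.erase β) ∈ F (n - d β - 1) := by
        have e1 := (h.deriv β).map_mem hTsum
        rw [map_sum, show n - 1 - d β = n - d β - 1 by ring] at e1
        have e2 : ∑ s ∈ T, (D β (b s * sortedMonomial x s) -
            s.count β • b s * sortedMonomial x (s.erase β)) ∈ F (n - d β - 1) :=
          Submodule.sum_mem _ fun s hs => h.apply_mul_sortedMonomial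
            (fun γ hγ => hβ γ (hmemV s hs γ hγ)) (hb s (hTS hs)) (hbn s (hTS hs))
        rw [Finset.sum_sub_distrib] at e2
        have := Submodule.sub_mem _ e1 e2
        rwa [sub_sub_cancel] at this
      let T' := T.filter fun s => β ∈ s
      -- Distinct monomials containing x_β have distinct derivatives, so no terms merge and the
      -- induction hypothesis applies to each coefficient.
      have hinj : Set.InjOn (fun s : Multiset Γ => s.erase β) T' := by
        intro s hs t ht hst
        rw [Finset.mem_coe, Finset.mem_filter] at hs ht
        rw [← Multiset.cons_erase hs.2, ← Multiset.cons_erase ht.2]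
        exact congrArg _ hst
      have hD2 : ∑ t ∈ T'.image (fun s => s.erase β),
          ((β ::ₘ t).count β • b (β ::ₘ t)) * sortedMonomial x t ∈ F (n - d β - 1) := by
        rw [Finset.sum_image hinj, Finset.sum_filter]
        convert hD1 using 1
        refine Finset.sum_congr rfl fun s _ => ?_
        split_ifs with hs
        · rw [Multiset.cons_erase hs]
        · rw [Multiset.count_eq_zero_of_notMem hs, zero_smul, zero_mul]
      have hpos := h.pos β
      have key := ih (n := n - d β) (S := T'.image fun s => s.erase β)
        (b := fun t => (β ::ₘ t).count β • b (β ::ₘ t)) ?_ ?_ hD2 (by push_cast at hN; omega)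
        (s₁.erase β) (Finset.mem_image_of_mem _ (Finset.mem_filter.2 ⟨hs₁, hs₁β⟩))
      · simp only [Multiset.cons_erase hs₁β] at key
        have hw : (weight d s₁ : ℤ) = d β + weight d (s₁.erase β) := by
          rw [← Nat.cast_add, ← weight_cons, Multiset.cons_erase hs₁β]
        -- Characteristic zero enters here: the exponent of x_β can be divided out.
        have hc : (s₁.count β : k) ≠ 0 := by
          rw [Nat.cast_ne_zero]
          exact (Multiset.count_pos.2 hs₁β).ne'
        rw [← Nat.cast_smul_eq_nsmul k, Submodule.smul_mem_iff _ hc] at key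
        apply (Finset.mem_filter.1 hs₁).2
        convert key using 2
        omega
      · intro t ht
        obtain ⟨s, hs, rfl⟩ := Finset.mem_image.1 ht
        obtain ⟨hs, hsβ⟩ := Finset.mem_filter.1 hs
        simp only [Multiset.cons_erase hsβ]
        exact nsmul_mem (hb s (hTS hs)) _
      · intro t ht
        obtain ⟨s, hs, rfl⟩ := Finset.mem_image.1 ht
        obtain ⟨hs, hsβ⟩ := Finset.mem_filter.1 hs
        have hw : (weight d s : ℤ) = d β + weight d (s.erase β) := by
          rw [← Nat.cast_add, ← weight_cons, Multiset.cons_erase hsβ]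
        simp only [Multiset.cons_erase hsβ]
        refine nsmul_mem ?_ _
        convert hbn s (hTS hs) using 2
        omega

/-- Each application of `coeff_mem` lowers all coefficients by one degree, until the degrees are
negative. The hypothesis on the sum is only a degree drop, so that it also covers relations with
coefficients on the right. -/
theorem coeff_eq_zero_of_forall [CharZero k] (h : IsPolynomialSystem F B x d D)
    (hex : ∀ a, ∃ n, a ∈ F n) {S : Finset (Multiset Γ)} {b : Multiset Γ → R}
    (hb : ∀ s ∈ S, b s ∈ B) (hsum : ∀ n, (∀ s ∈ S, b s ∈ F (n - weight d s)) →
      ∑ s ∈ S, b s * sortedMonomial x s ∈ F (n - 1)) :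
    ∀ s ∈ S, b s = 0 := by
  have hF := h.almostComm
  choose deg hdeg using hex
  obtain ⟨N, hN⟩ : ∃ N : ℤ, ∀ s ∈ S, deg (b s) + weight d s ≤ N := by
    obtain ⟨N, hN⟩ := (S.image fun s => deg (b s) + (weight d s : ℤ)).bddAbove
    exact ⟨N, fun s hs => hN (Finset.mem_coe.2 (Finset.mem_image_of_mem _ hs))⟩
  have key : ∀ m : ℕ, ∀ s ∈ S, b s ∈ F (N - m - weight d s) := by
    intro m
    induction m with
    | zero => exact fun s hs => hF.mono (by have := hN s hs; push_cast; omega) (hdeg (b s))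
    | succ m ih =>
      have := h.coeff_mem hb ih (hsum _ ih)
      intro s hs
      convert this s hs using 2
      push_cast
      ring
  intro s hs
  have := key (N.toNat + 1) s hs
  rwa [hF.eq_bot_of_neg _ (by push_cast; omega), Submodule.mem_bot] at this

theorem coeff_eq_zero [CharZero k] (h : IsPolynomialSystem F B x d D)
    (hex : ∀ a, ∃ n, a ∈ F n) {S : Finset (Multiset Γ)} {b : Multiset Γ → R}
    (hb : ∀ s ∈ S, b s ∈ B) (hsum : ∑ s ∈ S, b s * sortedMonomial x s = 0) :
    ∀ s ∈ S, b s = 0 :=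
  h.coeff_eq_zero_of_forall hex hb fun _ _ => by
    rw [hsum]
    exact Submodule.zero_mem _

theorem sortedMonomial_notMem [CharZero k] [Nontrivial R] (h : IsPolynomialSystem F B x d D)
    (s : Multiset Γ) : sortedMonomial x s ∉ F (weight d s - 1) := by
  intro hs
  have := h.coeff_mem (n := weight d s) (S := {s}) (b := fun _ => 1) (fun _ _ => B.one_mem)
    (fun t ht => by
      rw [Finset.mem_singleton.1 ht, sub_self]
      exact h.almostComm.one_mem) (by simpa using hs) s (Finset.mem_singleton_self s)
  rw [h.almostComm.eq_bot_of_neg _ (by omega), Submodule.mem_bot] at this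
  exact one_ne_zero this

theorem sortedMonomial_mul_sub_mul_mem (h : IsPolynomialSystem F B x d D) {n : ℤ}
    {s : Multiset Γ} {b : R} (hb : b ∈ F (n - weight d s)) :
    b * sortedMonomial x s - sortedMonomial x s * b ∈ F (n - 1) := by
  have := h.almostComm.comm_mem hb (h.almostComm.sortedMonomial_mem h.mem s)
  rwa [sub_add_cancel] at this

theorem coeff_eq_zero' [CharZero k] (h : IsPolynomialSystem F B x d D)
    (hex : ∀ a, ∃ n, a ∈ F n) {S : Finset (Multiset Γ)} {b : Multiset Γ → R}
    (hb : ∀ s ∈ S, b s ∈ B) (hsum : ∑ s ∈ S, sortedMonomial x s * b s = 0) :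
    ∀ s ∈ S, b s = 0 :=
  h.coeff_eq_zero_of_forall hex hb fun n hn => by
    have e : ∑ s ∈ S, (b s * sortedMonomial x s - sortedMonomial x s * b s) ∈ F (n - 1) :=
      Submodule.sum_mem _ fun s hs => h.sortedMonomial_mul_sub_mul_mem (hn s hs)
    rwa [Finset.sum_sub_distrib, hsum, sub_zero] at e

theorem sortedMonomial_singleton (γ : Γ) : sortedMonomial x {γ} = x γ := by
  simp [sortedMonomial]

theorem sortedMonomial_zero : sortedMonomial x (0 : Multiset Γ) = 1 := by
  simp [sortedMonomial]

variable (F B x d) in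
/-- The sum `∑ₛ Bₙ₋|ₛ| xˢ`. -/
def monomialSpan (n : ℤ) : Submodule k R :=
  ⨆ s : Multiset Γ, (Subalgebra.toSubmodule B ⊓ F (n - weight d s)).map
    (LinearMap.mulRight k (sortedMonomial x s))

variable (F B x d) in
/-- The sum `∑ₛ xˢ Bₙ₋|ₛ|`. -/
def monomialSpan' (n : ℤ) : Submodule k R :=
  ⨆ s : Multiset Γ, (Subalgebra.toSubmodule B ⊓ F (n - weight d s)).map
    (LinearMap.mulLeft k (sortedMonomial x s))

theorem mul_mem_monomialSpan {n : ℤ} {s : Multiset Γ} {b : R} (hb : b ∈ B)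
    (hbn : b ∈ F (n - weight d s)) : b * sortedMonomial x s ∈ monomialSpan F B x d n :=
  Submodule.mem_iSup_of_mem s ⟨b, ⟨hb, hbn⟩, rfl⟩

theorem mul_mem_monomialSpan' {n : ℤ} {s : Multiset Γ} {b : R} (hb : b ∈ B)
    (hbn : b ∈ F (n - weight d s)) : sortedMonomial x s * b ∈ monomialSpan' F B x d n :=
  Submodule.mem_iSup_of_mem s ⟨b, ⟨hb, hbn⟩, rfl⟩

theorem monomialSpan_le {n : ℤ} {P : Submodule k R}
    (h : ∀ s : Multiset Γ, ∀ b ∈ B, b ∈ F (n - weight d s) → b * sortedMonomial x s ∈ P) :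
    monomialSpan F B x d n ≤ P := by
  refine iSup_le fun s => ?_
  rintro _ ⟨b, hb, rfl⟩
  exact h s b hb.1 hb.2

theorem monomialSpan'_le {n : ℤ} {P : Submodule k R}
    (h : ∀ s : Multiset Γ, ∀ b ∈ B, b ∈ F (n - weight d s) → sortedMonomial x s * b ∈ P) :
    monomialSpan' F B x d n ≤ P := by
  refine iSup_le fun s => ?_
  rintro _ ⟨b, hb, rfl⟩
  exact h s b hb.1 hb.2

theorem monomialSpan_mono (h : IsPolynomialSystem F B x d D) :
    Monotone (monomialSpan F B x d) := fun _ _ hmn =>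
  monomialSpan_le fun _ _ hb hbn => mul_mem_monomialSpan hb (h.almostComm.mono (by omega) hbn)

theorem monomialSpan'_mono (h : IsPolynomialSystem F B x d D) :
    Monotone (monomialSpan' F B x d) := fun _ _ hmn =>
  monomialSpan'_le fun _ _ hb hbn => mul_mem_monomialSpan' hb (h.almostComm.mono (by omega) hbn)

/-- Moving the second coefficient past the first monomial, and sorting the merged monomial, both
produce errors of degree p + q - 1, which are in the span by assumption. -/
theorem mul_mem_of_mem_monomialSpan (h : IsPolynomialSystem F B x d D) {p q : ℤ}
    (hle : F (p + q - 1) ≤ monomialSpan F B x d (p + q - 1)) {a b : R}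
    (ha : a ∈ monomialSpan F B x d p) (hb : b ∈ monomialSpan F B x d q) :
    a * b ∈ monomialSpan F B x d (p + q) := by
  have hF := h.almostComm
  have hle' : F (p + q - 1) ≤ monomialSpan F B x d (p + q) :=
    hle.trans (h.monomialSpan_mono (by omega))
  have key : ∀ s : Multiset Γ, ∀ b ∈ B, b ∈ F (p - weight d s) →
      ∀ s' : Multiset Γ, ∀ b' ∈ B, b' ∈ F (q - weight d s') →
      (b * sortedMonomial x s) * (b' * sortedMonomial x s') ∈ monomialSpan F B x d (p + q) := by
    intro s b hb hbn s' b' hb' hbn'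
    have hbb := hF.mul_mem hbn hbn'
    have e1 : b * b' * sortedMonomial x (s + s') ∈ monomialSpan F B x d (p + q) := by
      refine mul_mem_monomialSpan (B.mul_mem hb hb') ?_
      rw [weight_add]
      convert hbb using 2
      push_cast
      ring
    have e2 := hF.mul_mem hbb (hF.sortedMonomial_mul_sub_mem h.mem s s')
    have e3 := hF.mul_mem (hF.mul_mem hbn (hF.comm_mem (hF.sortedMonomial_mem h.mem s) hbn'))
      (hF.sortedMonomial_mem h.mem s')
    rw [weight_add, show p - weight d s + (q - weight d s') +
      ((weight d s + weight d s' : ℕ) - 1) = p + q - 1 by push_cast; ring] at e2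
    rw [show p - weight d s + (weight d s + (q - weight d s') - 1) + weight d s' = p + q - 1 by
      ring] at e3
    convert Submodule.add_mem _ (Submodule.add_mem _ e1 (hle' e2)) (hle' e3) using 1
    noncomm_ring
  have h1 : monomialSpan F B x d p ≤ (monomialSpan F B x d (p + q)).comap
      (LinearMap.mulRight k b) := monomialSpan_le fun s c hc hcn => by
    have h2 : monomialSpan F B x d q ≤ (monomialSpan F B x d (p + q)).comap
        (LinearMap.mulLeft k (c * sortedMonomial x s)) := monomialSpan_le fun s' c' hc' hcn' =>
      key s c hc hcn s' c' hc' hcn'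
    exact h2 hb
  exact h1 ha

/-- Induction on the degree: modulo smaller degree, an element is a sum of a coefficient, new
generators and products of elements of smaller positive degree. -/
theorem le_monomialSpan (h : IsPolynomialSystem F B x d D) (n : ℤ) :
    F n ≤ monomialSpan F B x d n := by
  have hF := h.almostComm
  obtain ⟨N, hN⟩ : ∃ N : ℕ, n < N := ⟨n.toNat + 1, by omega⟩
  induction N generalizing n with
  | zero =>
    rw [hF.eq_bot_of_neg _ (by push_cast at hN; omega)]
    exact bot_le
  | succ N ih =>
    have hcoeff : ∀ b ∈ B, b ∈ F n → b ∈ monomialSpan F B x d n := by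
      intro b hb hbn
      rw [← mul_one b, ← sortedMonomial_zero (x := x)]
      exact mul_mem_monomialSpan hb (by simpa using hbn)
    rcases lt_trichotomy n 0 with hn | rfl | hn
    · rw [hF.eq_bot_of_neg _ hn]
      exact bot_le
    · exact fun a ha => hcoeff a (h.zero_le ha) ha
    · have hprev : F (n - 1) ≤ monomialSpan F B x d (n - 1) :=
        ih _ (by push_cast at hN; omega)
      lift n to ℕ using hn.le
      refine (h.le_sup n (by exact_mod_cast hn)).trans (sup_le (sup_le (sup_le ?_ ?_) ?_) ?_)
      · exact hprev.trans (h.monomialSpan_mono (by omega))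
      · exact fun a ha => hcoeff a ha.1 ha.2
      · refine Submodule.span_le.2 ?_
        rintro _ ⟨γ, hγ, rfl⟩
        rw [← sortedMonomial_singleton (x := x), SetLike.mem_coe, ← one_mul (sortedMonomial x _)]
        refine mul_mem_monomialSpan B.one_mem ?_
        have : weight d {γ} = n := by simpa [weight] using hγ
        rw [this, sub_self]
        exact hF.one_mem
      · refine iSup_le fun p => iSup_le fun q => iSup_le fun hp => iSup_le fun hq =>
          iSup_le fun hpq => Submodule.mul_le.2 fun a ha b hb => ?_
        have hpq' : (p : ℤ) + q = n := by exact_mod_cast hpq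
        rw [← hpq'] at hprev ⊢
        exact h.mul_mem_of_mem_monomialSpan hprev (ih _ (by push_cast at hN; omega) ha)
          (ih _ (by push_cast at hN; omega) hb)

theorem eq_monomialSpan (h : IsPolynomialSystem F B x d D) (n : ℤ) :
    F n = monomialSpan F B x d n := by
  refine le_antisymm (h.le_monomialSpan n) (monomialSpan_le fun s b _ hbn => ?_)
  have := h.almostComm.mul_mem hbn (h.almostComm.sortedMonomial_mem h.mem s)
  rwa [sub_add_cancel] at this

theorem eq_monomialSpan' (h : IsPolynomialSystem F B x d D) (n : ℤ) :
    F n = monomialSpan' F B x d n := by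
  have hF := h.almostComm
  refine le_antisymm ?_ (monomialSpan'_le fun s b _ hbn => ?_)
  · obtain ⟨N, hN⟩ : ∃ N : ℕ, n < N := ⟨n.toNat + 1, by omega⟩
    induction N generalizing n with
    | zero =>
      rw [hF.eq_bot_of_neg _ (by push_cast at hN; omega)]
      exact bot_le
    | succ N ih =>
      rw [h.eq_monomialSpan n]
      refine monomialSpan_le fun s b hb hbn => ?_
      have h1 := h.monomialSpan'_mono (show n - 1 ≤ n by omega)
        (ih (n - 1) (by push_cast at hN; omega) (h.sortedMonomial_mul_sub_mul_mem hbn))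
      have := Submodule.add_mem _ h1 (mul_mem_monomialSpan' (x := x) hb hbn)
      rwa [sub_add_cancel] at this
  · have := h.almostComm.mul_mem (h.almostComm.sortedMonomial_mem h.mem s) hbn
    rwa [add_sub_cancel] at this

end IsPolynomialSystem

end PolynomialSystems

/-! ### Construction of the generators and their dual functionals -/

section Existence

/-- Dual families spanning a complement of `W` in `P + W`. -/
theorem exists_dual_families {k : Type u} [Field k] {V : Type v} [AddCommGroup V] [Module k V]
    (W P : Submodule k V) : ∃ (I : Type v) (y : I → V) (f : I → V →ₗ[k] k),
      (∀ i, y i ∈ P) ∧ (∀ i, ∀ w ∈ W, f i w = 0) ∧ (∀ i, f i (y i) = 1) ∧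
      (∀ i j, j ≠ i → f i (y j) = 0) ∧ P ≤ W ⊔ Submodule.span k (Set.range y) := by
  -- Lifts to `P` of a basis of its image modulo `W`; the functionals extend the coordinate forms of
  -- that basis.
  let M : Submodule k (V ⧸ W) := P.map W.mkQ
  let b := Module.Basis.ofVectorSpace k M
  have hy : ∀ i, ∃ y ∈ P, W.mkQ y = b i := fun i => (b i).2
  choose y hyP hy using hy
  have hf : ∀ i, ∃ f : (V ⧸ W) →ₗ[k] k, f ∘ₗ M.subtype = b.coord i := fun i =>
    LinearMap.exists_extend (b.coord i)
  choose f hf using hf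
  have hfy : ∀ i j, f i (W.mkQ (y j)) = b.coord i (b j) := by
    intro i j
    rw [hy, ← hf]
    rfl
  refine ⟨_, y, fun i => f i ∘ₗ W.mkQ, hyP, fun i w hw => ?_, fun i => ?_, fun i j hij => ?_, ?_⟩
  · simp [(Submodule.Quotient.mk_eq_zero W).2 hw]
  · rw [LinearMap.comp_apply, hfy]
    simp
  · rw [LinearMap.comp_apply, hfy]
    simp [Finsupp.single_eq_of_ne' hij]
  · intro p hp
    have hmem : (⟨W.mkQ p, p, hp, rfl⟩ : M) ∈ Submodule.span k (Set.range b) := by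
      rw [b.span_eq]; exact Submodule.mem_top
    have h2 : W.mkQ p ∈ (Submodule.span k (Set.range y)).map W.mkQ := by
      have h3 := Submodule.mem_map_of_mem (f := M.subtype) hmem
      rw [Submodule.map_span, ← Set.range_comp] at h3
      rw [Submodule.map_span, ← Set.range_comp]
      rwa [show M.subtype ∘ b = W.mkQ ∘ y from funext fun i => (hy i).symm] at h3
    obtain ⟨z, hz, hzp⟩ := h2
    have h4 : p - z ∈ W := by
      rw [← Submodule.Quotient.eq]
      exact hzp.symm
    rw [← sub_add_cancel p z]
    exact Submodule.add_mem_sup h4 hz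

variable {k : Type u} [Field k] {R : Type v} [Ring R] [Bialgebra k R]

/-- The result has degree 0, hence is a scalar, and applying ε identifies the scalar. -/
theorem lact_eq_smul_one (hR : coradical k R = Submodule.span k {(1 : R)}) {n : ℕ}
    {f : R →ₗ[k] k} (hf : ∀ x ∈ intFiltration k R (n - 1), f x = 0) {a : R}
    (ha : a ∈ intFiltration k R n) : lact f a = f a • 1 := by
  have h := lact_mem_intFiltration_sub hR IsGroupLikeElem.one hf ha
  rw [sub_self, intFiltration_zero hR] at h
  obtain ⟨c, hc⟩ := Submodule.mem_span_singleton.1 h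
  have h2 := apply_lact f (Coalgebra.counit (R := k)) a
  rw [ract_counit, ← hc] at h2
  rw [← hc, ← h2]
  simp

/-- A connected bialgebra has a polynomial system over any subbialgebra. -/
theorem exists_isPolynomialSystem (hR : coradical k R = Submodule.span k {(1 : R)})
    {B : Subalgebra k R} (hB : IsSubcoalgebra k (Subalgebra.toSubmodule B)) :
    ∃ (Γ : Type v) (x : Γ → R) (d : Γ → ℕ) (D : Γ → R →ₗ[k] R),
      (∀ γ, Coalgebra.counit (R := k) (x γ) = 0) ∧
        IsPolynomialSystem (intFiltration k R) B x d D := by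
  have hF := isAlmostCommutative_intFiltration hR
  set F := intFiltration k R
  let P : ℕ → Submodule k R := fun n =>
    ⨆ (p : ℕ) (q : ℕ) (_ : 0 < p) (_ : 0 < q) (_ : p + q = n), F p * F q
  have hPF : ∀ n : ℕ, P n ≤ F n := fun n => iSup_le fun p => iSup_le fun q => iSup_le fun _ =>
    iSup_le fun _ => iSup_le fun hpq => Submodule.mul_le.2 fun a ha b hb => by
      rw [← hpq, Nat.cast_add]
      exact hF.mul_mem ha hb
  -- All of `B` is included, not only its part of degree n, so that the resulting operators kill
  -- every coefficient.
  let W : ℕ → Submodule k R := fun n => F (n - 1) ⊔ P n ⊔ Subalgebra.toSubmodule B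
  choose I y f hy hfW hf1 hf0 hspan using fun n : ℕ =>
    exists_dual_families (W (n + 1)) (F ((n + 1 : ℕ) : ℤ))
  have hBW : ∀ n, ∀ b ∈ B, b ∈ W n := fun n b hb => Submodule.mem_sup_right hb
  have h1W : ∀ n, 1 ∈ W n := fun n => hBW n 1 B.one_mem
  -- Generators are corrected to have counit zero; the functionals kill 1 and do not notice. The
  -- index n stands for degree n + 1, since no generators occur in degree 0.
  let x : (Σ n, I n) → R := fun γ =>
    y γ.1 γ.2 - Coalgebra.counit (R := k) (y γ.1 γ.2) • 1
  have hx : ∀ γ : Σ n, I n, x γ ∈ F ((γ.1 + 1 : ℕ) : ℤ) := fun γ =>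
    Submodule.sub_mem _ (hy _ _) (Submodule.smul_mem _ _ (hF.mono (by omega) hF.one_mem))
  have hfx : ∀ n (i : I n) γ, f n i (x γ) = f n i (y γ.1 γ.2) := by
    intro n i γ
    simp only [x]
    rw [map_sub, map_smul, hfW n i 1 (h1W _), smul_zero, sub_zero]
  have hkill : ∀ n (i : I n), ∀ z ∈ F (((n + 1 : ℕ) : ℤ) - 1), f n i z = 0 := fun n i z hz =>
    hfW n i z (Submodule.mem_sup_left (Submodule.mem_sup_left hz))
  refine ⟨Σ n, I n, x, fun γ => γ.1 + 1, fun γ => lact (f γ.1 γ.2), fun γ => ?_, hF,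
    ?_, fun γ => Nat.succ_pos _, hx, fun γ => ⟨fun ha => ?_, fun ha hb => ?_⟩,
    fun γ b hb => ?_, fun γ => ?_, fun γ β hβ hle => ?_, fun n hn => ?_⟩
  · simp [x]
  · rw [show F 0 = _ from intFiltration_zero hR, Submodule.span_singleton_le_iff_mem]
    exact B.one_mem
  · exact lact_mem_intFiltration_sub hR IsGroupLikeElem.one (hkill _ _) ha
  · refine lact_mul_sub_mem hR (by omega) (hkill _ _) ?_ ha hb
    intro p q hp hq hpq z hz w hw
    lift p to ℕ using hp.le
    lift q to ℕ using hq.le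
    refine hfW _ _ _ (Submodule.mem_sup_left (Submodule.mem_sup_right ?_))
    refine Submodule.mem_iSup_of_mem p (Submodule.mem_iSup_of_mem q (Submodule.mem_iSup_of_mem
      (by exact_mod_cast hp) (Submodule.mem_iSup_of_mem (by exact_mod_cast hq)
        (Submodule.mem_iSup_of_mem (by exact_mod_cast hpq) (Submodule.mul_mem_mul hz hw)))))
  · have h2 : LinearMap.range (TensorProduct.mapIncl (Subalgebra.toSubmodule B)
        (Subalgebra.toSubmodule B)) ≤ LinearMap.ker (contractFst (N := R) (f γ.1 γ.2)) :=
      range_mapIncl_induction fun z hz w _ => by simp [hfW γ.1 γ.2 z (hBW _ z hz)]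
    exact h2 (hB b hb)
  · rw [lact_eq_smul_one hR (hkill _ _) (hx γ), hfx, hf1, one_smul, sub_self]
    exact Submodule.zero_mem _
  · rcases hle.lt_or_eq with hlt | heq
    · have := lact_mem_intFiltration_sub hR IsGroupLikeElem.one (hkill γ.1 γ.2) (hx β)
      rw [intFiltration_of_neg (by omega), Submodule.mem_bot] at this
      rw [this]
      exact Submodule.zero_mem _
    · obtain ⟨n, i⟩ := γ
      obtain ⟨m, j⟩ := β
      obtain rfl : m = n := by simpa using heq
      have := lact_eq_smul_one hR (n := m + 1) (hkill m i) (hx ⟨m, j⟩)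
      rw [hfx m i ⟨m, j⟩, hf0 m i j (fun h => hβ (by rw [h])), zero_smul] at this
      rw [this]
      exact Submodule.zero_mem _
  · obtain ⟨n, rfl⟩ : ∃ m, n = m + 1 := ⟨n - 1, by omega⟩
    intro a ha
    have hX : Submodule.span k (Set.range (y n)) ≤
        W (n + 1) ⊔ Submodule.span k (x '' {γ | γ.1 + 1 = n + 1}) := by
      refine Submodule.span_le.2 ?_
      rintro _ ⟨i, rfl⟩
      rw [SetLike.mem_coe, ← sub_add_cancel (y n i) (x ⟨n, i⟩)]
      refine Submodule.add_mem_sup ?_ (Submodule.subset_span ⟨⟨n, i⟩, rfl, rfl⟩)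
      simp only [x, sub_sub_cancel]
      exact Submodule.smul_mem _ _ (h1W _)
    obtain ⟨w, hw, z, hz, rfl⟩ := Submodule.mem_sup.1
      (sup_le le_sup_left hX (hspan n ha))
    obtain ⟨c, hc, b, hb, rfl⟩ := Submodule.mem_sup.1 hw
    have hcF : c ∈ F (n + 1 : ℕ) :=
      (sup_le (hF.mono (by omega)) (hPF (n + 1)) : _ ≤ F (n + 1 : ℕ)) hc
    have hzF : z ∈ F (n + 1 : ℕ) := by
      refine (Submodule.span_le.2 ?_ : Submodule.span k _ ≤ F (n + 1 : ℕ)) hz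
      rintro _ ⟨γ, hγ, rfl⟩
      rw [Set.mem_ofPred_eq] at hγ
      rw [SetLike.mem_coe, ← hγ]
      exact hx γ
    -- The component in `B` has no a priori degree bound; it inherits one as the difference of
    -- elements of degree n + 1.
    have hbF : b ∈ F (n + 1 : ℕ) := by
      have := Submodule.sub_mem _ (Submodule.sub_mem _ ha hzF) hcF
      rwa [add_sub_cancel_right, add_sub_cancel_left] at this
    obtain ⟨c₁, hc₁, c₂, hc₂, rfl⟩ := Submodule.mem_sup.1 hc
    rw [show c₁ + c₂ + b + z = c₁ + b + z + c₂ by abel]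
    exact Submodule.add_mem_sup (Submodule.add_mem_sup (Submodule.add_mem_sup hc₁ ⟨hb, hbF⟩) hz) hc₂

end Existence

/-! ### Gelfand–Kirillov dimension by counting monomials -/

section GelfandKirillov

open Filter Topology

variable {k : Type*} [Field k] {R : Type*} [Ring R] [Algebra k R]

theorem finiteDimensional_sum_pow (V : Submodule k R) [FiniteDimensional k V] (n : ℕ) :
    FiniteDimensional k (∑ i ∈ Finset.range (n + 1), V ^ i : Submodule k R) := by
  have hV : V.FG := Module.Finite.iff_fg.1 inferInstance
  refine Module.Finite.iff_fg.2 ?_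
  induction n with
  | zero =>
    rw [zero_add, Finset.sum_range_one, pow_zero, Submodule.one_eq_span]
    exact Submodule.fg_span_singleton _
  | succ n ih =>
    rw [Finset.sum_range_succ]
    exact ih.sup (hV.pow _)

theorem pow_le_sum_pow (V : Submodule k R) {i n : ℕ} (h : i ≤ n) :
    V ^ i ≤ ∑ i ∈ Finset.range (n + 1), V ^ i := by
  induction n with
  | zero => simp [Nat.le_zero.1 h]
  | succ n ih =>
    rw [Finset.sum_range_succ]
    rcases h.lt_or_eq with h | rfl
    · exact (ih (by omega)).trans le_sup_left
    · exact le_sup_right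

theorem sum_pow_le {V P : Submodule k R} {n : ℕ} (h : ∀ i ≤ n, V ^ i ≤ P) :
    ∑ i ∈ Finset.range (n + 1), V ^ i ≤ P := by
  induction n with
  | zero => simpa using h 0 le_rfl
  | succ n ih =>
    rw [Finset.sum_range_succ]
    exact sup_le (ih fun i hi => h i (by omega)) (h _ le_rfl)

theorem tendsto_logb_mul_pow {c : ℝ} (hc : 0 < c) (m : ℕ) :
    Tendsto (fun n : ℕ => ENNReal.ofReal (Real.logb n ((c * n) ^ m))) atTop (𝓝 m) := by
  have h1 : Tendsto (fun n : ℕ => (m : ℝ) * (Real.log c / Real.log n + 1)) atTop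
      (𝓝 (m * (0 + 1))) := by
    refine ((Tendsto.div_atTop tendsto_const_nhds
      (Real.tendsto_log_atTop.comp tendsto_natCast_atTop_atTop)).add_const 1).const_mul _
  have h2 := (ENNReal.continuous_ofReal.tendsto _).comp h1
  simp only [zero_add, mul_one, ENNReal.ofReal_natCast] at h2
  refine h2.congr' ?_
  filter_upwards [eventually_ge_atTop 2] with n hn
  have hn0 : (0 : ℝ) < n := by positivity
  have hlog : Real.log n ≠ 0 := (Real.log_pos (by exact_mod_cast hn)).ne'
  simp only [Function.comp_apply]
  rw [Real.logb, Real.log_pow, Real.log_mul hc.ne' hn0.ne']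
  congr 1
  field_simp

theorem card_le_gkdim {ι : Type*} [Fintype ι] (V : Submodule k R) [FiniteDimensional k V]
    {e : (ι → ℕ) → R} (hli : LinearIndependent k e) (he : ∀ a, e a ∈ V ^ ∑ i, a i) :
    (Fintype.card ι : ℝ≥0∞) ≤ gkdim k R := by
  classical
  set m := Fintype.card ι with hm
  rcases Nat.eq_zero_or_pos m with h0 | hmpos
  · simp [h0]
  refine le_trans ?_ (le_iSup₂ (f := fun (V : Submodule k R) (_ : FiniteDimensional k V) =>
    limsup (fun n : ℕ => ENNReal.ofReal (Real.logb n (Module.finrank k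
      (∑ i ∈ Finset.range (n + 1), V ^ i : Submodule k R)))) atTop) V inferInstance)
  rw [← (tendsto_logb_mul_pow (c := 1 / m) (by positivity) m).limsup_eq]
  refine limsup_le_limsup ?_
  filter_upwards [eventually_ge_atTop 2] with n hn
  refine ENNReal.ofReal_le_ofReal (Real.logb_le_logb_of_le (by exact_mod_cast hn) (by positivity) ?_)
  have := finiteDimensional_sum_pow V n
  -- Exponents bounded by n / m keep the total degree at most n and already give at least (n / m)^m
  -- monomials.
  let q := n / m
  have hq : m * q ≤ n := Nat.mul_div_le n m
  let g : (ι → Fin (q + 1)) → (∑ i ∈ Finset.range (n + 1), V ^ i : Submodule k R) := fun a =>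
    ⟨e fun i => a i, pow_le_sum_pow V (le_trans (Finset.sum_le_card_nsmul _ _ q fun i _ => by
      have := (a i).2; omega) (by simpa [← hm] using hq)) (he _)⟩
  have hg : LinearIndependent k g := by
    refine LinearIndependent.of_comp (Submodule.subtype _) ?_
    refine hli.comp (fun (a : ι → Fin (q + 1)) i => (a i : ℕ)) fun a b hab => ?_
    funext i
    exact Fin.ext (congrFun hab i)
  have hcard := hg.fintype_card_le_finrank
  rw [Fintype.card_fun, Fintype.card_fin, ← hm] at hcard
  have hle : (1 / m : ℝ) * n ≤ ((q + 1 : ℕ) : ℝ) := by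
    rw [one_div, inv_mul_le_iff₀ (by positivity)]
    exact_mod_cast (Nat.lt_mul_div_succ n hmpos).le
  calc ((1 / m : ℝ) * n) ^ m ≤ ((q + 1 : ℕ) : ℝ) ^ m := by gcongr
    _ ≤ _ := by exact_mod_cast hcard

/-- A finite-dimensional V lies in some `G D`, so its powers up to n lie in `G (D * n)`, which is
spanned by at most (Dn + 1)^m elements. -/
theorem gkdim_le_card {ι : Type*} [Fintype ι] {G : ℕ → Submodule k R} (hmono : Monotone G)
    (hex : ∀ a, ∃ n, a ∈ G n) (hone : 1 ∈ G 0) (hmul : ∀ i j, G i * G j ≤ G (i + j))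
    {e : (ι → ℕ) → R} (he : ∀ n, G n ≤ Submodule.span k (e '' {a | ∀ i, a i ≤ n})) :
    gkdim k R ≤ Fintype.card ι := by
  classical
  refine iSup₂_le fun V hV => ?_
  obtain ⟨D, hD⟩ : ∃ D, V ≤ G D := by
    obtain ⟨s, rfl⟩ := Module.Finite.iff_fg.1 hV
    choose deg hdeg using hex
    refine ⟨s.sup deg, Submodule.span_le.2 fun a ha => ?_⟩
    exact hmono (Finset.le_sup ha) (hdeg a)
  have hpow : ∀ i, V ^ i ≤ G (D * i) := by
    intro i
    induction i with
    | zero => simpa [Submodule.one_eq_span] using hone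
    | succ i ih =>
      rw [pow_succ, Nat.mul_succ]
      exact (mul_le_mul' ih hD).trans (hmul _ _)
  set m := Fintype.card ι with hm
  rw [← (tendsto_logb_mul_pow (c := (D + 1 : ℕ)) (by positivity) m).limsup_eq]
  refine limsup_le_limsup ?_
  filter_upwards [eventually_ge_atTop 2] with n hn
  have hfin : (e '' {a | ∀ i, a i ≤ D * n}) = e '' (Fintype.piFinset fun _ : ι =>
      Finset.range (D * n + 1) : Finset (ι → ℕ)) := by
    congr 1
    ext a
    simp
  have hle : ∑ i ∈ Finset.range (n + 1), V ^ i ≤ Submodule.span k (e '' {a | ∀ i, a i ≤ D * n}) :=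
    sum_pow_le fun i hi => (hpow i).trans ((hmono (Nat.mul_le_mul_left D hi)).trans (he _))
  rw [hfin, ← Finset.coe_image] at hle
  have hrank := (Submodule.finrank_mono hle).trans
    ((finrank_span_finset_le_card _).trans Finset.card_image_le)
  rw [Fintype.card_piFinset, Finset.prod_const, Finset.card_univ, Finset.card_range, ← hm] at hrank
  refine ENNReal.ofReal_le_ofReal ?_
  rcases Nat.eq_zero_or_pos (Module.finrank k (∑ i ∈ Finset.range (n + 1), V ^ i : Submodule k R))
    with h0 | hpos
  -- Monotonicity of the logarithm needs a positive argument; at dimension 0 the default value `logb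
  -- n 0 = 0` is compared directly.
  · rw [h0, Nat.cast_zero, Real.logb_zero]
    refine Real.logb_nonneg (by exact_mod_cast hn) (one_le_pow₀ ?_)
    exact_mod_cast Nat.mul_pos D.succ_pos (by omega)
  · refine Real.logb_le_logb_of_le (by exact_mod_cast hn) (by exact_mod_cast hpos) ?_
    calc (Module.finrank k (∑ i ∈ Finset.range (n + 1), V ^ i : Submodule k R) : ℝ)
        ≤ ((D * n + 1 : ℕ) : ℝ) ^ m := by exact_mod_cast hrank
      _ ≤ _ := by
        gcongr
        have : D * n + 1 ≤ (D + 1) * n := by nlinarith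
        exact_mod_cast this

/-- An algebra with a filtered basis of monomials in the family `z` has Gelfand-Kirillov dimension
the number of elements of the family. -/
theorem gkdim_eq_card {Γ : Type*} {G : ℕ → Submodule k R} (hmono : Monotone G)
    (hex : ∀ a, ∃ n, a ∈ G n) (hone : 1 ∈ G 0) (hmul : ∀ i j, G i * G j ≤ G (i + j))
    {z : Γ → R} {e : (Γ →₀ ℕ) → R} (hli : LinearIndependent k e)
    (hz : ∀ (V : Submodule k R) (a : Γ →₀ ℕ), (∀ i ∈ a.support, z i ∈ V) → e a ∈ V ^ a.degree)
    (he : ∀ n, G n ≤ Submodule.span k (e '' {a | ∀ i, a i ≤ n})) :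
    gkdim k R = (ENat.card Γ : ℝ≥0∞) := by
  classical
  have hlower : ∀ T : Finset Γ, (T.card : ℝ≥0∞) ≤ gkdim k R := by
    intro T
    let V := Submodule.span k (T.image z : Set R)
    let ext : (T → ℕ) → (Γ →₀ ℕ) := fun a =>
      (Finsupp.equivFunOnFinite.symm a).embDomain (Function.Embedding.subtype _)
    have hext : Function.Injective ext :=
      (Finsupp.embDomain_injective _).comp Finsupp.equivFunOnFinite.symm.injective
    have := card_le_gkdim (e := e ∘ ext) V (hli.comp _ hext) fun a => by
      have h1 := hz V (ext a) fun i hi => by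
        rw [Finsupp.support_embDomain] at hi
        obtain ⟨j, _, rfl⟩ := Finset.mem_map.1 hi
        exact Submodule.subset_span (Finset.mem_coe.2 (Finset.mem_image_of_mem _ j.2))
      have h2 : (ext a).degree = ∑ i, a i := by
        simp only [ext]
        rw [Finsupp.embDomain_eq_mapDomain, Finsupp.degree_mapDomain, Finsupp.degree_eq_sum]
        rfl
      rwa [h2] at h1
    simpa using this
  rcases finite_or_infinite Γ with hfin | hinf
  · have := Fintype.ofFinite Γ
    rw [ENat.card_eq_coe_fintype_card]
    refine le_antisymm ?_ (by simpa using hlower Finset.univ)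
    refine (gkdim_le_card hmono hex hone hmul
      (e := e ∘ Finsupp.equivFunOnFinite.symm) fun n => ?_).trans (by simp)
    convert he n using 2
    rw [Set.image_comp]
    congr 1
    ext a
    simp [Equiv.image_eq_preimage_symm]
  · rw [ENat.card_eq_top_of_infinite]
    -- An infinite family contains finite subfamilies of every size, so the lower bounds are
    -- unbounded.
    refine ENNReal.eq_top_of_forall_nnreal_le fun r => ?_
    obtain ⟨n, hn⟩ := exists_nat_ge r
    obtain ⟨T, hT⟩ := Infinite.exists_subset_card_eq Γ n
    refine le_trans ?_ (hlower T)
    rw [hT]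
    exact_mod_cast hn

end GelfandKirillov

/-! ### Ordered monomials as products and as bases -/

section SortedMonomials

variable {k : Type*} [Field k] {R : Type*} [Ring R] [Algebra k R] {Γ : Type*}

theorem list_prod_map_mem_pow {x : Γ → R} {V : Submodule k R} {l : List Γ}
    (h : ∀ γ ∈ l, x γ ∈ V) : (l.map x).prod ∈ V ^ l.length := by
  induction l with
  | nil => simp [Submodule.one_eq_span]
  | cons γ l ih =>
    rw [List.map_cons, List.prod_cons, List.length_cons, pow_succ']
    exact Submodule.mul_mem_mul (h γ List.mem_cons_self)
      (ih fun γ' hγ' => h γ' (List.mem_cons_of_mem _ hγ'))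

theorem count_le_weight [DecidableEq Γ] {d : Γ → ℕ} (hd : ∀ γ, 0 < d γ) (γ : Γ) (s : Multiset Γ) :
    s.count γ ≤ weight d s := by
  refine (Multiset.count_le_card γ s).trans ?_
  induction s using Multiset.induction_on with
  | empty => simp
  | cons β s ih =>
    rw [Multiset.card_cons, weight_cons]
    have := hd β
    omega

variable [LinearOrder Γ] {x : Γ → R} {d : Γ → ℕ}

theorem sortedMonomial_mem_pow {V : Submodule k R} {s : Multiset Γ} (h : ∀ γ ∈ s, x γ ∈ V) :
    sortedMonomial x s ∈ V ^ Multiset.card s := by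
  rw [← Multiset.length_sort (r := (· ≤ ·))]
  exact list_prod_map_mem_pow fun γ hγ => h γ ((Multiset.mem_sort _).1 hγ)

theorem sortedMonomial_toMultiset_mem_pow {V : Submodule k R} {a : Γ →₀ ℕ}
    (h : ∀ γ ∈ a.support, x γ ∈ V) :
    sortedMonomial x (Finsupp.toMultiset a) ∈ V ^ a.degree := by
  have := sortedMonomial_mem_pow (x := x) (V := V) (s := Finsupp.toMultiset a)
    fun γ hγ => h γ ((Finsupp.mem_toMultiset a γ).1 hγ)
  rwa [Finsupp.card_toMultiset] at this

theorem orderedMonomial_eq_sortedMonomial (w : {l : List Γ // l.Pairwise (· ≤ ·)}) :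
    orderedMonomial x w = sortedMonomial x (w.1 : Multiset Γ) := by
  rw [orderedMonomial, sortedMonomial, Multiset.coe_sort, List.mergeSort_eq_self (r := (· ≤ ·)) w.2]

theorem coe_sortedList_injective :
    Function.Injective fun w : {l : List Γ // l.Pairwise (· ≤ ·)} => (w.1 : Multiset Γ) := by
  intro w w' h
  exact Subtype.ext ((Multiset.coe_eq_coe.1 h).eq_of_pairwise' w.2 w'.2)

theorem coe_sortedList_surjective :
    Function.Surjective fun w : {l : List Γ // l.Pairwise (· ≤ ·)} => (w.1 : Multiset Γ) := fun s =>
  ⟨⟨s.sort (· ≤ ·), s.pairwise_sort (· ≤ ·)⟩, s.sort_eq (· ≤ ·)⟩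

namespace IsPolynomialSystem

variable {F : ℤ → Submodule k R} {D : Γ → R →ₗ[k] R}

theorem linearIndependent_of_bot [CharZero k] [Nontrivial R]
    (h : IsPolynomialSystem F (⊥ : Subalgebra k R) x d D) (hex : ∀ a, ∃ n, a ∈ F n) :
    LinearIndependent k (sortedMonomial x) := by
  rw [linearIndependent_iff']
  intro S g hg s hs
  have := h.coeff_eq_zero hex (S := S) (b := fun s => algebraMap k R (g s))
    (fun s _ => Subalgebra.algebraMap_mem _ _) (by simpa [Algebra.smul_def] using hg) s hs
  exact (map_eq_zero_iff _ (algebraMap k R).injective).1 this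

theorem le_span_of_bot (h : IsPolynomialSystem F (⊥ : Subalgebra k R) x d D) (n : ℤ) :
    F n ≤ Submodule.span k (sortedMonomial x '' {s | (weight d s : ℤ) ≤ n}) := by
  rw [h.eq_monomialSpan n]
  refine monomialSpan_le fun s b hb hbn => ?_
  obtain ⟨c, rfl⟩ := Algebra.mem_bot.1 hb
  rw [← Algebra.smul_def]
  rcases lt_or_ge n (weight d s) with hlt | hge
  · rw [h.almostComm.eq_bot_of_neg _ (by omega), Submodule.mem_bot] at hbn
    rw [Algebra.smul_def, hbn, zero_mul]
    exact Submodule.zero_mem _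
  · exact Submodule.smul_mem _ _ (Submodule.subset_span ⟨s, hge, rfl⟩)

theorem linearIndependent {B : Subalgebra k R} [CharZero k]
    (h : IsPolynomialSystem F B x d D) (hex : ∀ a, ∃ n, a ∈ F n) :
    LinearIndependent B (sortedMonomial x) := by
  classical
  rw [linearIndependent_iff']
  intro S g hg s hs
  exact Subtype.ext (h.coeff_eq_zero hex (S := S) (b := fun s => (g s : R))
    (fun s _ => (g s).2) hg s hs)

theorem linearIndependent_op {B : Subalgebra k R} [CharZero k]
    (h : IsPolynomialSystem F B x d D) (hex : ∀ a, ∃ n, a ∈ F n) :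
    LinearIndependent B.op (sortedMonomial x) := by
  classical
  rw [linearIndependent_iff']
  intro S g hg s hs
  exact Subtype.ext (MulOpposite.unop_injective
    (h.coeff_eq_zero' hex (S := S) (b := fun s => (g s : Rᵐᵒᵖ).unop) (fun s _ => (g s).2) hg s hs))

end IsPolynomialSystem

end SortedMonomials

/-! ### Gelfand–Kirillov dimension of connected bialgebras -/

section GelfandKirillov

variable {k : Type*} [Field k] {R : Type*} [Ring R] [Bialgebra k R]

theorem gkdim_eq_of_intFiltration (hR : coradical k R = Submodule.span k {(1 : R)}) {Γ : Type*}
    {z : Γ → R} {e : (Γ →₀ ℕ) → R} (hli : LinearIndependent k e)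
    (hz : ∀ (V : Submodule k R) (a : Γ →₀ ℕ), (∀ i ∈ a.support, z i ∈ V) → e a ∈ V ^ a.degree)
    (he : ∀ n : ℕ, intFiltration k R n ≤ Submodule.span k (e '' {a | ∀ i, a i ≤ n})) :
    gkdim k R = (ENat.card Γ : ℝ≥0∞) :=
  gkdim_eq_card (G := coradicalFiltration k R)
    (coradicalFiltration_mono hR IsGroupLikeElem.one)
    (exists_mem_coradicalFiltration hR IsGroupLikeElem.one)
    (isAlmostCommutative_intFiltration hR).one_mem
    (fun i j => Submodule.mul_le.2 fun a ha b hb => by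
      rw [← intFiltration_natCast, Nat.cast_add]
      exact intFiltration_mul_mem hR ha hb) hli hz he

theorem IsPolynomialSystem.gkdim_eq [CharZero k] (hR : coradical k R = Submodule.span k {(1 : R)}) [Nontrivial R]
    {Γ : Type*} [LinearOrder Γ] {x : Γ → R} {d : Γ → ℕ} {D : Γ → R →ₗ[k] R}
    (h : IsPolynomialSystem (intFiltration k R) ⊥ x d D) (hex : ∀ a, ∃ n, a ∈ intFiltration k R n) :
    gkdim k R = (ENat.card Γ : ℝ≥0∞) := by
  refine gkdim_eq_of_intFiltration hR (z := x)
    (e := fun a => sortedMonomial x (Finsupp.toMultiset a))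
    ((h.linearIndependent_of_bot hex).comp _ Multiset.toFinsupp.symm.injective)
    (fun V a ha => sortedMonomial_toMultiset_mem_pow ha) fun n => (h.le_span_of_bot n).trans ?_
  refine Submodule.span_mono ?_
  rintro _ ⟨s, hs, rfl⟩
  refine ⟨Multiset.toFinsupp s, fun i => ?_, by simp⟩
  rw [Set.mem_ofPred_eq] at hs
  simpa using (count_le_weight h.pos i s).trans (by exact_mod_cast hs)

end GelfandKirillov

/-! ### Hopf subalgebras and filter bases -/

section HopfSubalgebras

variable {k : Type*} [Field k] {H : Type*} [Ring H] [HopfAlgebra k H]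

theorem IsConnectedHopfAlgebra.coradical_eq (hH : IsConnectedHopfAlgebra k H) :
    coradical k H = Submodule.span k {(1 : H)} := by
  rw [IsConnectedHopfAlgebra] at hH
  have : FiniteDimensional k (coradical k H) := Module.finite_of_finrank_eq_succ hH
  have hs := isSimpleSubcoalgebra_span_singleton (k := k) (IsGroupLikeElem.one (R := k) (A := H))
  have h1 : (1 : H) ≠ 0 := by
    rintro h
    exact hs.2.1 (by rw [h, Submodule.span_zero_singleton])
  have hle : Submodule.span k {(1 : H)} ≤ coradical k H := le_sSup hs
  refine (Submodule.eq_of_le_of_finrank_eq hle ?_).symm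
  rw [finrank_span_singleton h1]
  exact hH.symm

theorem IsConnectedHopfAlgebra.nontrivial (hH : IsConnectedHopfAlgebra k H) : Nontrivial H := by
  by_contra h
  rw [not_nontrivial_iff_subsingleton] at h
  rw [IsConnectedHopfAlgebra, Module.finrank_zero_of_subsingleton] at hH
  exact zero_ne_one hH

namespace HopfSubalgebra

variable (K : HopfSubalgebra k H)

theorem map_val_comul (a : K.toSubalgebra) :
    Algebra.TensorProduct.map K.toSubalgebra.val K.toSubalgebra.val
      (Coalgebra.comul (R := k) a) = Coalgebra.comul (R := k) (a : H) :=
  LinearMap.congr_fun K.isSubcoalgebra.mapIncl_comp_comul a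

theorem map_val_injective : Function.Injective
    (Algebra.TensorProduct.map K.toSubalgebra.val K.toSubalgebra.val) :=
  mapIncl_injective (Subalgebra.toSubmodule K.toSubalgebra) (Subalgebra.toSubmodule K.toSubalgebra)

/-- A Hopf subalgebra is a bialgebra. -/
@[reducible]
noncomputable def bialgebra : Bialgebra k K.toSubalgebra :=
  Bialgebra.mk' k K.toSubalgebra (Bialgebra.counit_one (R := k) (A := H))
    (fun {a b} => Bialgebra.counit_mul (R := k) (a : H) b)
    (K.map_val_injective (by rw [K.map_val_comul, map_one]; exact Bialgebra.comul_one))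
    (fun {a b} => K.map_val_injective (by
      rw [K.map_val_comul, map_mul, K.map_val_comul, K.map_val_comul]
      exact Bialgebra.comul_mul (a : H) b))

/-- The inclusion of a Hopf subalgebra, as a morphism of coalgebras. -/
noncomputable def inclusion : K.toSubalgebra →ₗc[k] H :=
  { K.toSubalgebra.val.toLinearMap with
    counit_comp := rfl
    map_comp_comul := K.isSubcoalgebra.mapIncl_comp_comul }

theorem inclusion_injective : Function.Injective K.inclusion := Subtype.val_injective

theorem isGroupLikeElem_one : IsGroupLikeElem k (1 : K.toSubalgebra) :=
  letI := K.bialgebra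
  IsGroupLikeElem.one

theorem coradical_eq (hH : coradical k H = Submodule.span k {(1 : H)}) :
    coradical k K.toSubalgebra = Submodule.span k {1} :=
  coradical_eq_of_injective K.inclusion_injective K.isGroupLikeElem_one hH

/-- The inclusion is an injective coalgebra map, so the intrinsic filtration of `K` is the induced
one. Hence filter bases can be studied inside `H`. -/
theorem filtration_eq (hH : coradical k H = Submodule.span k {(1 : H)}) (n : ℕ) :
    K.filtration n = Subalgebra.toSubmodule K.toSubalgebra ⊓ coradicalFiltration k H n := by
  have key : ∀ a : K.toSubalgebra, a ∈ coradicalFiltration k K.toSubalgebra n ↔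
      (a : H) ∈ coradicalFiltration k H n := fun a =>
    mem_coradicalFiltration_iff_of_injective K.inclusion_injective K.isGroupLikeElem_one hH
  ext a
  constructor
  · rintro ⟨b, hb, rfl⟩
    exact ⟨b.2, (key b).1 hb⟩
  · rintro ⟨ha, ha'⟩
    exact ⟨⟨a, ha⟩, (key ⟨a, ha⟩).2 ha', rfl⟩

end HopfSubalgebra

variable {K : HopfSubalgebra k H} {Γ : Type*} [LinearOrder Γ] {x : Γ → H} {d : Γ → ℕ}
  {D : Γ → H →ₗ[k] H}

namespace IsPolynomialSystem

theorem coradicalDegree_eq [CharZero k] [Nontrivial H]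
    (h : IsPolynomialSystem (intFiltration k H) K.toSubalgebra x d D) (s : Multiset Γ) :
    coradicalDegree k (sortedMonomial x s) = weight d s := by
  refine le_antisymm (Nat.sInf_le (h.almostComm.sortedMonomial_mem h.mem s)) ?_
  refine le_csInf ⟨_, h.almostComm.sortedMonomial_mem h.mem s⟩ fun n hn => ?_
  by_contra hlt
  exact h.sortedMonomial_notMem s (h.almostComm.mono (show (n : ℤ) ≤ _ by omega) hn)

theorem isLeftFilterBasis [CharZero k] [Nontrivial H]
    (hH : coradical k H = Submodule.span k {(1 : H)})
    (h : IsPolynomialSystem (intFiltration k H) K.toSubalgebra x d D) :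
    IsLeftFilterBasis K (orderedMonomial x) := by
  have hex := exists_mem_coradicalFiltration hH IsGroupLikeElem.one
  have hfil : ∀ n : ℕ, coradicalFiltration k H n =
      ⨆ (w : {l : List Γ // l.Pairwise (· ≤ ·)}) (_ : coradicalDegree k (orderedMonomial x w) ≤ n),
        (K.filtration (n - coradicalDegree k (orderedMonomial x w))).map
          (LinearMap.mulRight k (orderedMonomial x w)) := by
    intro n
    simp only [orderedMonomial_eq_sortedMonomial, h.coradicalDegree_eq, K.filtration_eq hH]
    refine le_antisymm ?_ (iSup₂_le fun w hw => ?_)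
    · refine (h.le_monomialSpan n).trans (monomialSpan_le fun s b hb hbn => ?_)
      obtain ⟨w, rfl⟩ := coe_sortedList_surjective s
      -- If the monomial is heavier than n, its coefficient has negative degree and vanishes;
      -- otherwise natural and integer subtraction agree.
      rcases lt_or_ge n (weight d (w.1 : Multiset Γ)) with hlt | hge
      · rw [h.almostComm.eq_bot_of_neg _ (by simp only; omega), Submodule.mem_bot] at hbn
        rw [hbn, zero_mul]
        exact Submodule.zero_mem _
      · refine Submodule.mem_iSup_of_mem w (Submodule.mem_iSup_of_mem hge ⟨b, ⟨hb, ?_⟩, rfl⟩)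
        rwa [← Nat.cast_sub hge] at hbn
    · rintro _ ⟨b, hb, rfl⟩
      rw [← intFiltration_natCast, h.eq_monomialSpan n]
      refine mul_mem_monomialSpan hb.1 ?_
      rw [← Nat.cast_sub hw]
      exact hb.2
  refine ⟨?_, ?_, hfil⟩
  · have := (h.linearIndependent fun a => (hex a).imp' (fun n : ℕ => (n : ℤ)) fun n hn => hn).comp _
      (coe_sortedList_injective (Γ := Γ))
    convert this using 1
    exact funext orderedMonomial_eq_sortedMonomial
  · rw [eq_top_iff]
    intro a _
    obtain ⟨n, hn⟩ := hex a
    rw [hfil] at hn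
    refine (show (⨆ (w : {l : List Γ // l.Pairwise (· ≤ ·)})
      (_ : coradicalDegree k (orderedMonomial x w) ≤ n), _) ≤
      (Submodule.span K.toSubalgebra (Set.range (orderedMonomial x))).restrictScalars k from
        iSup₂_le fun w hw => ?_) hn
    rintro _ ⟨b, hb, rfl⟩
    rw [K.filtration_eq hH] at hb
    exact Submodule.smul_mem _ (⟨b, hb.1⟩ : K.toSubalgebra) (Submodule.subset_span ⟨w, rfl⟩)

theorem isRightFilterBasis [CharZero k] [Nontrivial H]
    (hH : coradical k H = Submodule.span k {(1 : H)})
    (h : IsPolynomialSystem (intFiltration k H) K.toSubalgebra x d D) :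
    IsRightFilterBasis K (orderedMonomial x) := by
  have hex := exists_mem_coradicalFiltration hH IsGroupLikeElem.one
  have hfil : ∀ n : ℕ, coradicalFiltration k H n =
      ⨆ (w : {l : List Γ // l.Pairwise (· ≤ ·)}) (_ : coradicalDegree k (orderedMonomial x w) ≤ n),
        (K.filtration (n - coradicalDegree k (orderedMonomial x w))).map
          (LinearMap.mulLeft k (orderedMonomial x w)) := by
    intro n
    simp only [orderedMonomial_eq_sortedMonomial, h.coradicalDegree_eq, K.filtration_eq hH]
    refine le_antisymm ?_ (iSup₂_le fun w hw => ?_)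
    · refine (h.eq_monomialSpan' n).le.trans (monomialSpan'_le fun s b hb hbn => ?_)
      obtain ⟨w, rfl⟩ := coe_sortedList_surjective s
      rcases lt_or_ge n (weight d (w.1 : Multiset Γ)) with hlt | hge
      · rw [h.almostComm.eq_bot_of_neg _ (by simp only; omega), Submodule.mem_bot] at hbn
        rw [hbn, mul_zero]
        exact Submodule.zero_mem _
      · refine Submodule.mem_iSup_of_mem w (Submodule.mem_iSup_of_mem hge ⟨b, ⟨hb, ?_⟩, rfl⟩)
        rwa [← Nat.cast_sub hge] at hbn
    · rintro _ ⟨b, hb, rfl⟩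
      rw [← intFiltration_natCast, h.eq_monomialSpan' n]
      refine mul_mem_monomialSpan' hb.1 ?_
      rw [← Nat.cast_sub hw]
      exact hb.2
  refine ⟨?_, ?_, hfil⟩
  · have := (h.linearIndependent_op fun a =>
      (hex a).imp' (fun n : ℕ => (n : ℤ)) fun n hn => hn).comp _ (coe_sortedList_injective (Γ := Γ))
    convert this using 1
    exact funext orderedMonomial_eq_sortedMonomial
  · rw [eq_top_iff]
    intro a _
    obtain ⟨n, hn⟩ := hex a
    rw [hfil] at hn
    refine (show (⨆ (w : {l : List Γ // l.Pairwise (· ≤ ·)})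
      (_ : coradicalDegree k (orderedMonomial x w) ≤ n), _) ≤
      (Submodule.span K.toSubalgebra.op (Set.range (orderedMonomial x))).restrictScalars k from
        iSup₂_le fun w hw => ?_) hn
    rintro _ ⟨b, hb, rfl⟩
    rw [K.filtration_eq hH] at hb
    exact Submodule.smul_mem _ (⟨MulOpposite.op b, hb.1⟩ : K.toSubalgebra.op)
      (Submodule.subset_span ⟨w, rfl⟩)

end IsPolynomialSystem

end HopfSubalgebras

/-! ### The main theorem -/

theorem isSubcoalgebra_bot {k : Type*} [Field k] {R : Type*} [Ring R] [Bialgebra k R] :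
    IsSubcoalgebra k (Subalgebra.toSubmodule (⊥ : Subalgebra k R)) := by
  rw [Algebra.toSubmodule_bot, Submodule.one_eq_span]
  exact isSubcoalgebra_span_singleton (IsGroupLikeElem.one (R := k)).comul_eq_tmul_self

theorem mainTheorem4 {k : Type u} [Field k] [CharZero k] {H : Type v} [Ring H] [HopfAlgebra k H]
    (hH : IsConnectedHopfAlgebra k H) (K : HopfSubalgebra k H) :
    ∃ (Γ : Type v) (_ : LinearOrder Γ) (x : Γ → H),
      (∀ γ, Coalgebra.counit (R := k) (x γ) = 0) ∧
      gkdim k H = gkdim k K.toSubalgebra + (ENat.card Γ : ℝ≥0∞) ∧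
      IsLeftFilterBasis K (orderedMonomial x) ∧
      IsRightFilterBasis K (orderedMonomial x) := by
  have hcor := hH.coradical_eq
  have hnt := hH.nontrivial
  have hexH : ∀ a : H, ∃ n : ℤ, a ∈ intFiltration k H n := fun a =>
    (exists_mem_coradicalFiltration hcor IsGroupLikeElem.one a).imp' (fun n : ℕ => (n : ℤ))
      fun n hn => hn
  let _ := K.bialgebra
  have hcorK := K.coradical_eq hcor
  have hexK : ∀ a : K.toSubalgebra, ∃ n : ℤ, a ∈ intFiltration k K.toSubalgebra n := fun a =>
    (exists_mem_coradicalFiltration hcorK K.isGroupLikeElem_one a).imp' (fun n : ℕ => (n : ℤ))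
      fun n hn => hn
  obtain ⟨Γ, x, d, D, hx, h⟩ := exists_isPolynomialSystem hcor K.isSubcoalgebra
  obtain ⟨Δ, y, c, E, -, hy⟩ := exists_isPolynomialSystem hcorK
    (isSubcoalgebra_bot (k := k) (R := K.toSubalgebra))
  -- Any total order serves, since reordering the factors changes a monomial only in lower degree.
  let oΓ : LinearOrder Γ := IsWellOrder.linearOrder WellOrderingRel
  let oΔ : LinearOrder Δ := IsWellOrder.linearOrder WellOrderingRel
  refine ⟨Γ, oΓ, x, hx, ?_, h.isLeftFilterBasis hcor, h.isRightFilterBasis hcor⟩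
  -- The k-basis of `H` consists of products of an ordered monomial of `K` with an ordered monomial
  -- over `K`, so the generators of `H` are indexed by the disjoint union.
  rw [hy.gkdim_eq hcorK hexK, gkdim_eq_of_intFiltration (Γ := Δ ⊕ Γ) hcor
    (z := Sum.elim (fun δ => (y δ : H)) x)
    (e := fun a => ((sortedMonomial y (Finsupp.toMultiset
      (Finsupp.sumFinsuppEquivProdFinsupp a).1) : K.toSubalgebra) : H) *
        sortedMonomial x (Finsupp.toMultiset (Finsupp.sumFinsuppEquivProdFinsupp a).2)) ?_ ?_ ?_]
  · rw [ENat.card_sum, ENat.toENNReal_add]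
  · refine (linearIndependent_smul (hy.linearIndependent_of_bot hexK)
      (h.linearIndependent hexH)).comp (fun a : Δ ⊕ Γ →₀ ℕ =>
        (Finsupp.toMultiset (Finsupp.sumFinsuppEquivProdFinsupp a).1,
          Finsupp.toMultiset (Finsupp.sumFinsuppEquivProdFinsupp a).2)) fun a b hab => ?_
    rw [Prod.mk.injEq] at hab
    exact Finsupp.sumFinsuppEquivProdFinsupp.injective
      (Prod.ext (Multiset.toFinsupp.symm.injective hab.1) (Multiset.toFinsupp.symm.injective hab.2))
  · intro V a ha
    have hdeg : a.degree = (Finsupp.sumFinsuppEquivProdFinsupp a).1.degree +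
        (Finsupp.sumFinsuppEquivProdFinsupp a).2.degree := by
      obtain ⟨p, rfl⟩ := Finsupp.sumFinsuppEquivProdFinsupp.symm.surjective a
      rw [Equiv.apply_symm_apply]
      change (Finsupp.sumElim p.1 p.2).degree = _
      rw [Finsupp.sumElim_eq_add, map_add, Finsupp.degree_mapDomain, Finsupp.degree_mapDomain]
    have hval : ((sortedMonomial y (Finsupp.toMultiset
        (Finsupp.sumFinsuppEquivProdFinsupp a).1) : K.toSubalgebra) : H) =
        sortedMonomial (fun δ => (y δ : H)) (Finsupp.toMultiset
          (Finsupp.sumFinsuppEquivProdFinsupp a).1) := by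
      rw [sortedMonomial, sortedMonomial, SubmonoidClass.coe_list_prod, List.map_map]
      rfl
    rw [hdeg, pow_add, hval]
    refine Submodule.mul_mem_mul (sortedMonomial_toMultiset_mem_pow fun δ hδ => ?_)
      (sortedMonomial_toMultiset_mem_pow fun γ hγ => ?_)
    · exact ha (Sum.inl δ) (by simpa using hδ)
    · exact ha (Sum.inr γ) (by simpa using hγ)
  · intro n
    refine (h.le_monomialSpan n).trans
      (IsPolynomialSystem.monomialSpan_le fun s b hb hbn => ?_)
    rcases lt_or_ge n (weight d s) with hlt | hge
    · rw [h.almostComm.eq_bot_of_neg _ (by omega), Submodule.mem_bot] at hbn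
      rw [hbn, zero_mul]
      exact Submodule.zero_mem _
    rw [← Nat.cast_sub hge] at hbn
    -- The coefficient is expanded in monomials of `K` by its intrinsic degree. As generators have
    -- positive degree, every exponent is bounded by a weight and hence by n.
    obtain ⟨b, hb', rfl⟩ : b ∈ K.filtration (n - weight d s) := by
      rw [K.filtration_eq hcor]
      exact ⟨hb, hbn⟩
    refine (?_ : Submodule.span k _ ≤ (Submodule.span k _).comap (LinearMap.mulRight k
      (sortedMonomial x s) ∘ₗ K.toSubalgebra.val.toLinearMap)) (hy.le_span_of_bot (n - weight d s : ℕ) hb')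
    refine Submodule.span_le.2 ?_
    rintro _ ⟨t, ht, rfl⟩
    rw [Set.mem_ofPred_eq] at ht
    have ht' : weight c t ≤ n - weight d s := by exact_mod_cast ht
    refine Submodule.subset_span ⟨Finsupp.sumFinsuppEquivProdFinsupp.symm
      (Multiset.toFinsupp t, Multiset.toFinsupp s), ?_, by simp⟩
    rintro (δ | γ)
    · simpa using (count_le_weight hy.pos δ t).trans (ht'.trans (Nat.sub_le _ _))
    · simpa using (count_le_weight h.pos γ s).trans hge
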